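/- For each $n\ge 1$ let $A_n=(x^{(n)}_{ij})_{1\le i,j\le n}$ be a random $n\times n$ matrix with complex entries whose rows are independent random vectors in $\mathbb{C}^n$ (not necessarily identically distributed). Assume: (A1) for every $k\in\mathbb{N}$, $\sup_n\max_{1\le i,j\le n}\mathbb{E}\big[|x^{(n)}_{ij}|^k\big]<\infty$; (A2) for every $k\in\mathbb{N}$, $$\sum \Big|\,\mathbb{E}\Big[\prod_{l=1}^{k}x^{(n)}_{r_lc_l}\ \prod_{l=k+1}^{2k}\overline{x^{(n)}_{r_lc_l}}\Big]\Big| = o(n^{k+1})\qquad(n\to\infty),$$ where the sum runs over all $(r_l)_{l\le 2k},(c_l)_{l\le 2k}\in\{1,\dots,n\}^{2k}$ for which some position $(i,j)$ occurs exactly once among $(r_1,c_1),\dots,(r_{2k},c_{2k})$ (that is, the sum of the sizes of all the terms of the moment tensor $\mathbb{E}[A_n^{\otimes k}\otimes\overline{A_n}^{\otimes k}]$ in which at least one entry of $A_n$ appears with power $1$; for real entries the tensor is $\mathbb{E}[A_n^{\otimes 2k}]$); (A3) for every $\varepsilon>0$, $$\lim_{n\to\infty}\frac1n\sum_{i=1}^n\mathbb{P}\Big(\Big|\frac1n\sum_{j=1}^n|x^{(n)}_{ij}|^2-1\Big|\ge\varepsilon\Big)=0\quad\text{and}\quad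 \lim_{n\to\infty}\frac1n\sum_{j=1}^n\mathbb{P}\Big(\Big|\frac1n\sum_{i=1}^n|x^{(n)}_{ij}|^2-1\Big|\ge\varepsilon\Big)=0 .$$ For $z\in\mathbb{C}$ put $H_n(z)=\big(\tfrac1{\sqrt n}A_n-zI\big)\big(\tfrac1{\sqrt n}A_n-zI\big)^*$. Then for every $k\in\mathbb{N}$ and every $z\in\mathbb{C}$ the random variable $\operatorname{tr}H_n(z)^k$ is integrable for every $n$, and $$\lim_{n\to\infty}\frac1n\,\mathbb{E}\big[\operatorname{tr}H_n(z)^k\big]=\mu_k(|z|^2),$$ where the functions $\mu_k:[0,\infty)\to\mathbb{R}$ are universal: they depend neither on $z$ otherwise than through $|z|^2$, nor on the distributions of the rows, nor on the sequence $(A_n)$. -/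

import Mathlib

open MeasureTheory ProbabilityTheory Filter Topology Asymptotics
open scoped Matrix ENNReal ComplexConjugate

noncomputable section

namespace RowMatrix

/-- A random `n × n` matrix on `Ω` is a map `Ω → Matrix (Fin n) (Fin n) ℂ`.  This is
`H(z) = (A / √n - z I) (A / √n - z I)^*`. -/
def hermitized {n : ℕ} (A : Matrix (Fin n) (Fin n) ℂ) (z : ℂ) : Matrix (Fin n) (Fin n) ℂ :=
  (((Real.sqrt n : ℝ) : ℂ)⁻¹ • A - z • (1 : Matrix (Fin n) (Fin n) ℂ)) *
    (((Real.sqrt n : ℝ) : ℂ)⁻¹ • A - z • (1 : Matrix (Fin n) (Fin n) ℂ))ᴴ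

/-- The entry at the row multi-index `r` and column multi-index `c` of the moment tensor
`E [A ⊗ ⋯ ⊗ A ⊗ conj A ⊗ ⋯ ⊗ conj A]` of order `2 k` (`k` factors of each kind; for a real
matrix this is the expectation of the `2 k`-fold Kronecker power of `A`). -/
def momentEntry {n : ℕ} {Ω : Type*} [MeasurableSpace Ω] (P : Measure Ω)
    (A : Ω → Matrix (Fin n) (Fin n) ℂ) (k : ℕ) (r c : Fin k ⊕ Fin k → Fin n) : ℂ :=
  ∫ ω, (∏ l : Fin k, A ω (r (Sum.inl l)) (c (Sum.inl l))) *
    ∏ l : Fin k, conj (A ω (r (Sum.inr l)) (c (Sum.inr l))) ∂P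

/-- Some matrix position occurs exactly once among the positions `(r l, c l)`. -/
def HasSimplePosition {n k : ℕ} (r c : Fin k ⊕ Fin k → Fin n) : Prop :=
  ∃ l, ∀ l', (r l', c l') = (r l, c l) → l' = l

open Classical in
/-- The sum of the sizes of all the terms of the moment tensor of order `2 k` in which
some matrix entry appears with power one. -/
def simpleMomentSum {n : ℕ} {Ω : Type*} [MeasurableSpace Ω] (P : Measure Ω)
    (A : Ω → Matrix (Fin n) (Fin n) ℂ) (k : ℕ) : ℝ :=
  ∑ r : Fin k ⊕ Fin k → Fin n, ∑ c : Fin k ⊕ Fin k → Fin n,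
    if HasSimplePosition r c then ‖momentEntry P A k r c‖ else 0

/-- Assumption (A1): all absolute moments of the entries are bounded, uniformly in
`n` and in the position. -/
def AssumptionA1 {Ω : ℕ → Type*} [∀ n, MeasurableSpace (Ω n)] (P : ∀ n, Measure (Ω n))
    (A : ∀ n, Ω n → Matrix (Fin n) (Fin n) ℂ) : Prop :=
  ∀ k : ℕ, (⨆ n : ℕ, ⨆ i : Fin n, ⨆ j : Fin n, ∫⁻ ω, ‖A n ω i j‖ₑ ^ k ∂(P n)) < ∞

/-- Assumption (A2): for every `k`, the sum of the terms of the moment tensor of order `2 k`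
in which some entry appears with power one is `o(n ^ (k + 1))`. -/
def AssumptionA2 {Ω : ℕ → Type*} [∀ n, MeasurableSpace (Ω n)] (P : ∀ n, Measure (Ω n))
    (A : ∀ n, Ω n → Matrix (Fin n) (Fin n) ℂ) : Prop :=
  ∀ k : ℕ, (fun n : ℕ => simpleMomentSum (P n) (A n) k) =o[atTop]
    fun n : ℕ => (n : ℝ) ^ (k + 1)

/-- Assumption (A3): the normalized squared Euclidean norms of the rows and of the columns
converge to one in probability, on average over the rows and over the columns. -/
def AssumptionA3 {Ω : ℕ → Type*} [∀ n, MeasurableSpace (Ω n)] (P : ∀ n, Measure (Ω n))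
    (A : ∀ n, Ω n → Matrix (Fin n) (Fin n) ℂ) : Prop :=
  ∀ ε : ℝ, 0 < ε →
    Tendsto (fun n : ℕ => (1 / (n : ℝ)) * ∑ i : Fin n,
      (P n).real {ω | ε ≤ |((1 / (n : ℝ)) * ∑ j : Fin n, ‖A n ω i j‖ ^ 2) - 1|}) atTop (𝓝 0) ∧
    Tendsto (fun n : ℕ => (1 / (n : ℝ)) * ∑ j : Fin n,
      (P n).real {ω | ε ≤ |((1 / (n : ℝ)) * ∑ i : Fin n, ‖A n ω i j‖ ^ 2) - 1|}) atTop (𝓝 0)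

end RowMatrix

end

/-! This is the moment method, with independence replaced by (A2). Expanding `H(z) ^ k` gives
finitely many words in `A / √n` and its adjoint, with powers of `-z` and `-conj z` as coefficients,
and the trace of a word is a sum over closed walks on the indices. It is enough to show that each
word has a limit depending only on its letters (`tendsto_word`).

For a word with `p` letters of each kind, the walks using some matrix position exactly once are
absorbed by (A2). A closed walk of length `2 * p` without such a position has at most `p + 1`
vertices, and if it has that many it runs around a plane tree, each edge once in each direction
(`isDoubledTree_of_card`). By (A1) the walks with at most `p` vertices contribute `O(n ^ p)`, which
the normalization `n ^ (p + 1)` kills. On a tree the product of entries is a product of factors `|x|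
^ 2`; summing out a leaf produces a normalized squared row or column norm, which (A3) allows to be
replaced by one. By induction on leaves each tree shape contributes one in the limit
(`tendsto_average_doubledTree`), and the limit of the word is the number of shapes.

For an unbalanced word (A2) says nothing directly about the mean of the trace. Its squared modulus,
however, is a sum over pairs of closed walks with balanced conjugations. Since unbalanced walks
cannot run around a tree, such a pair without simple positions has at most `m + 1` vertices
(`card_vertices_union_le`), one too few for the normalization `n ^ (m + 2)`. So these words vanish
in the limit. In the surviving words `-z` and `-conj z` have equal exponents, whence the dependence
on `|z| ^ 2` alone (`limitMoment_normSq`). -/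

namespace RowMatrix

/-! ### Combinatorics of closed walks: vertex bounds and the tree case of equality. -/

section Walks

variable {V : Type*}

/-- The matrix position used by a step from `a` to `b`: the factor `A` is read at `(a, b)`, the
factor `Aᴴ` at `(b, a)`. -/
def position (ε : Bool) (a b : V) : V × V := if ε then (a, b) else (b, a)

/-- The letters and positions along the walk that starts at `a` and makes the steps `s`. -/
def edgeList : V → List (Bool × V) → List (Bool × (V × V))
  | _, [] => []
  | a, x :: s => (x.1, position x.1 a x.2) :: edgeList x.2 s

/-- The last vertex of a walk. -/
def endpoint : V → List (Bool × V) → V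
  | a, [] => a
  | _, x :: s => endpoint x.2 s

@[simp] lemma edgeList_nil (a : V) : edgeList a [] = [] := rfl

@[simp] lemma edgeList_cons (a : V) (x : Bool × V) (s : List (Bool × V)) :
    edgeList a (x :: s) = (x.1, position x.1 a x.2) :: edgeList x.2 s := rfl

@[simp] lemma endpoint_nil (a : V) : endpoint a [] = a := rfl

@[simp] lemma endpoint_cons (a : V) (x : Bool × V) (s : List (Bool × V)) :
    endpoint a (x :: s) = endpoint x.2 s := rfl

@[simp] lemma edgeList_append (a : V) (s t : List (Bool × V)) :
    edgeList a (s ++ t) = edgeList a s ++ edgeList (endpoint a s) t := by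
  induction s generalizing a with
  | nil => rfl
  | cons x s ih => simp [ih]

@[simp] lemma endpoint_append (a : V) (s t : List (Bool × V)) :
    endpoint a (s ++ t) = endpoint (endpoint a s) t := by
  induction s generalizing a with
  | nil => rfl
  | cons x s ih => simp [ih]

@[simp] lemma length_edgeList (a : V) (s : List (Bool × V)) :
    (edgeList a s).length = s.length := by
  induction s generalizing a with
  | nil => rfl
  | cons x s ih => simp [ih]

lemma endpoint_mem (a : V) {s : List (Bool × V)} (hs : s ≠ []) :
    endpoint a s ∈ s.map Prod.snd := by
  induction s generalizing a with
  | nil => exact absurd rfl hs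
  | cons x s ih =>
    rcases eq_or_ne s [] with rfl | h
    · simp
    · exact List.mem_cons_of_mem _ (ih x.2 h)

lemma mem_vertices_of_mem_edgeList {a : V} {s : List (Bool × V)} {x : Bool × (V × V)}
    (hx : x ∈ edgeList a s) :
    (x.2.1 ∈ a :: s.map Prod.snd) ∧ (x.2.2 ∈ a :: s.map Prod.snd) := by
  induction s generalizing a with
  | nil => simp at hx
  | cons y s ih =>
    rw [edgeList_cons, List.mem_cons] at hx
    rcases hx with rfl | hx
    · rcases y with ⟨ε, b⟩
      cases ε <;> simp [position]
    · obtain ⟨h1, h2⟩ := ih hx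
      simp only [List.map_cons]
      exact ⟨List.mem_cons_of_mem _ h1, List.mem_cons_of_mem _ h2⟩

/-- Closed walks that run around a plane tree, every edge being used once in each direction. -/
inductive IsDoubledTree (a : V) : List (Bool × V) → Prop
  | nil : IsDoubledTree a []
  | insert (ε : Bool) (b : V) (s t : List (Bool × V)) (hab : b ≠ a)
      (hs : b ∉ s.map Prod.snd) (ht : b ∉ t.map Prod.snd) (h : IsDoubledTree a (s ++ t)) :
      IsDoubledTree a (s ++ (ε, b) :: (!ε, endpoint a s) :: t)

/-- Every leaf insertion adds one letter together with its opposite. -/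
lemma IsDoubledTree.count_eq {a : V} {s : List (Bool × V)} (h : IsDoubledTree a s) :
    (s.map Prod.fst).count true = (s.map Prod.fst).count false := by
  induction h with
  | nil => rfl
  | insert ε b s t _ _ _ _ ih =>
    simp only [List.map_append, List.count_append, List.map_cons] at ih ⊢
    cases ε <;> simp <;> omega

variable [DecidableEq V]

/-- No element of the list occurs exactly once. -/
def NoSimple {α : Type*} [BEq α] (l : List α) : Prop := ∀ x ∈ l, 2 ≤ l.count x

/-- The set of vertices of a walk. -/
def vertices (a : V) (s : List (Bool × V)) : Finset V := insert a (s.map Prod.snd).toFinset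

lemma mem_vertices {a b : V} {s : List (Bool × V)} :
    b ∈ vertices a s ↔ b = a ∨ b ∈ s.map Prod.snd := by
  simp [vertices]

lemma count_edgeList_eq_zero {a b : V} {s : List (Bool × V)} (hab : b ≠ a)
    (hs : b ∉ s.map Prod.snd) {e : V × V} (he : e.1 = b ∨ e.2 = b) :
    ((edgeList a s).map Prod.snd).count e = 0 := by
  rw [List.count_eq_zero]
  intro h
  obtain ⟨x, hx, rfl⟩ := List.mem_map.1 h
  obtain ⟨h1, h2⟩ := mem_vertices_of_mem_edgeList hx
  have hb : b ∉ a :: s.map Prod.snd := by simp only [List.mem_cons, not_or]; exact ⟨hab, hs⟩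
  rcases he with rfl | rfl
  · exact hb h1
  · exact hb h2

/-- In a closed walk without simple positions, a vertex visited exactly once is a leaf. -/
lemma exists_leaf {a b : V} {s : List (Bool × V)} (hc : endpoint a s = a)
    (hs : NoSimple ((edgeList a s).map Prod.snd)) (hab : b ≠ a)
    (hb : (s.map Prod.snd).count b = 1) :
    ∃ (ε : Bool) (s₁ s₂ : List (Bool × V)), b ∉ s₁.map Prod.snd ∧ b ∉ s₂.map Prod.snd ∧
      s = s₁ ++ (ε, b) :: (!ε, endpoint a s₁) :: s₂ := by
  have hmem : b ∈ s.map Prod.snd := List.count_pos_iff.1 (by omega)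
  obtain ⟨⟨ε, b'⟩, hx, rfl⟩ := List.mem_map.1 hmem
  obtain ⟨s₁, t, rfl⟩ := List.append_of_mem hx
  simp only [List.map_append, List.map_cons, List.count_append, List.count_cons_self] at hb
  have h1 : b' ∉ s₁.map Prod.snd := List.count_eq_zero.1 (by omega)
  have h2 : b' ∉ t.map Prod.snd := List.count_eq_zero.1 (by omega)
  rcases t with _ | ⟨⟨ε', u⟩, s₂⟩
  · simp only [endpoint_append, endpoint_cons, endpoint_nil] at hc
    exact absurd hc hab
  · simp only [List.map_cons, List.mem_cons, not_or] at h2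
    refine ⟨ε, s₁, s₂, h1, h2.2, ?_⟩
    have hpos := hs (position ε (endpoint a s₁) b') (by simp)
    have he : (position ε (endpoint a s₁) b').1 = b' ∨
        (position ε (endpoint a s₁) b').2 = b' := by cases ε <;> simp [position]
    simp only [edgeList_append, edgeList_cons, List.map_append, List.map_cons, List.count_append,
      List.count_cons_self, count_edgeList_eq_zero hab h1 he, List.count_cons,
      count_edgeList_eq_zero h2.1 h2.2 he] at hpos
    -- Only the steps into and out of `b'` can use a position containing `b'`, so the outgoing step
    -- must repeat the incoming position. As `u ≠ b'`, equality of the ordered pairs forces the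
    -- opposite letter and a return to `endpoint a s₁`.
    have hp : position ε' b' u = position ε (endpoint a s₁) b' := by
      by_contra hne
      simp [hne] at hpos
    have hu : u ≠ b' := fun h => h2.1 h.symm
    cases ε <;> cases ε' <;> simp_all [position]

/-- The two deleted steps use positions containing `b`, so the multiplicities of the remaining
positions do not change. -/
lemma noSimple_remove_leaf {a b : V} {ε : Bool} {s t : List (Bool × V)} (hab : b ≠ a)
    (hs : b ∉ s.map Prod.snd) (ht : b ∉ t.map Prod.snd)
    (h : NoSimple ((edgeList a (s ++ (ε, b) :: (!ε, endpoint a s) :: t)).map Prod.snd)) :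
    NoSimple ((edgeList a (s ++ t)).map Prod.snd) := by
  intro e he
  have hb : ¬ (e.1 = b ∨ e.2 = b) := by
    intro hb
    have := count_edgeList_eq_zero (s := s ++ t) hab (by simp_all) hb
    exact List.count_eq_zero.1 this he
  have hne1 : position ε (endpoint a s) b ≠ e := by
    rintro rfl; cases ε <;> simp [position] at hb
  have hne2 : position (!ε) b (endpoint a s) ≠ e := by
    rintro rfl; cases ε <;> simp [position] at hb
  have := h e (by simp only [edgeList_append, edgeList_cons, List.map_append, List.map_cons,
    List.mem_append, List.mem_cons] at he ⊢; tauto)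
  simp only [edgeList_append, edgeList_cons, List.map_append, List.map_cons, List.count_append,
    List.count_cons_of_ne hne1, List.count_cons_of_ne hne2] at this ⊢
  exact this

/-- Pigeonhole: the closed walk arrives at `a` at least once, so if it arrived at every other vertex
at least twice, its length would be at least `2 * (card - 1) + 1`, contradicting `hcard`. -/
lemma exists_count_eq_one {a : V} {s : List (Bool × V)} (hc : endpoint a s = a) (hne : s ≠ [])
    (hcard : s.length + 2 ≤ 2 * (vertices a s).card) :
    ∃ b, b ≠ a ∧ (s.map Prod.snd).count b = 1 := by
  by_contra! hcon
  have ha : a ∈ (s.map Prod.snd).toFinset := by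
    rw [List.mem_toFinset]
    simpa [hc] using endpoint_mem a hne
  have hv : vertices a s = (s.map Prod.snd).toFinset := Finset.insert_eq_of_mem ha
  have hsum := List.sum_toFinset_count_eq_length (s.map Prod.snd)
  rw [← Finset.add_sum_erase _ _ ha, List.length_map] at hsum
  have h1 : 1 ≤ (s.map Prod.snd).count a := List.count_pos_iff.2 (List.mem_toFinset.1 ha)
  have h2 : ((s.map Prod.snd).toFinset.erase a).card • 2 ≤
      ∑ x ∈ (s.map Prod.snd).toFinset.erase a, (s.map Prod.snd).count x := by
    refine Finset.card_nsmul_le_sum _ _ _ fun b hb => ?_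
    rw [Finset.mem_erase, List.mem_toFinset] at hb
    have := List.count_pos_iff.2 hb.2
    have := hcon b hb.1
    omega
  rw [Finset.card_erase_of_mem ha, smul_eq_mul] at h2
  rw [hv] at hcard
  omega

/-- A closed walk without simple positions has at most `length / 2 + 1` vertices, and if it has
that many then it runs around a tree. -/
theorem isDoubledTree_of_card {a : V} {s : List (Bool × V)} (hc : endpoint a s = a)
    (hs : NoSimple ((edgeList a s).map Prod.snd))
    (hcard : s.length + 2 ≤ 2 * (vertices a s).card) :
    2 * (vertices a s).card = s.length + 2 ∧ IsDoubledTree a s := by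
  induction hN : s.length using Nat.strong_induction_on generalizing s with
  | _ N ih =>
    rcases eq_or_ne s [] with rfl | hne
    · simp only [List.length_nil] at hN
      subst hN
      exact ⟨by simp [vertices], .nil⟩
    -- Deleting a leaf removes two steps and one vertex, so both `hcard` and the claimed equality
    -- pass between the walk and the shorter one.
    obtain ⟨b, hab, hb⟩ := exists_count_eq_one hc hne hcard
    obtain ⟨ε, s₁, s₂, h1, h2, rfl⟩ := exists_leaf hc hs hab hb
    have hc' : endpoint a (s₁ ++ s₂) = a := by simpa using hc
    have hv : vertices a (s₁ ++ (ε, b) :: (!ε, endpoint a s₁) :: s₂) =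
        insert b (vertices a (s₁ ++ s₂)) := by
      ext x
      have : endpoint a s₁ = a ∨ endpoint a s₁ ∈ s₁.map Prod.snd := by
        rcases eq_or_ne s₁ [] with rfl | h
        · exact .inl rfl
        · exact .inr (endpoint_mem a h)
      simp only [mem_vertices, Finset.mem_insert, List.map_append, List.map_cons, List.mem_append,
        List.mem_cons]
      constructor
      · rintro (h | h | h | h | h)
        · tauto
        · tauto
        · tauto
        · subst h; tauto
        · tauto
      · tauto
    have hbn : b ∉ vertices a (s₁ ++ s₂) := by
      rw [mem_vertices]; simp only [List.map_append, List.mem_append]; tauto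
    rw [hv, Finset.card_insert_of_notMem hbn] at hcard ⊢
    simp only [List.length_append, List.length_cons] at hN hcard
    obtain ⟨h3, h4⟩ := ih _ (by rw [List.length_append]; omega) hc'
      (noSimple_remove_leaf hab h1 h2 hs) (by rw [List.length_append]; omega) rfl
    rw [List.length_append] at h3
    exact ⟨by omega, .insert ε b s₁ s₂ hab h1 h2 h4⟩

lemma two_mul_card_vertices_le {a : V} {s : List (Bool × V)} (hc : endpoint a s = a)
    (hs : NoSimple ((edgeList a s).map Prod.snd)) :
    2 * (vertices a s).card ≤ s.length + 2 := by
  by_contra! h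
  have := (isDoubledTree_of_card hc hs h.le).1
  omega

/-- Equality in the vertex bound forces a doubled tree, whose letters are balanced. -/
lemma two_mul_card_vertices_lt {a : V} {s : List (Bool × V)} (hc : endpoint a s = a)
    (hs : NoSimple ((edgeList a s).map Prod.snd))
    (hw : (s.map Prod.fst).count true ≠ (s.map Prod.fst).count false) :
    2 * (vertices a s).card ≤ s.length + 1 := by
  by_contra! h
  exact hw (isDoubledTree_of_card hc hs h).2.count_eq

/-- A closed walk may be started at any of its vertices. -/
lemma exists_rotation {a u : V} {s : List (Bool × V)} (hc : endpoint a s = a)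
    (hu : u ∈ vertices a s) :
    ∃ t, endpoint u t = u ∧ (edgeList u t).Perm (edgeList a s) ∧ vertices u t = vertices a s := by
  rcases eq_or_ne u a with rfl | hne
  · exact ⟨s, hc, .refl _, rfl⟩
  have hu' : u ∈ s.map Prod.snd := (mem_vertices.1 hu).resolve_left hne
  obtain ⟨⟨ε, b⟩, hx, rfl⟩ := List.mem_map.1 hu'
  obtain ⟨s₁, s₂, rfl⟩ := List.append_of_mem hx
  simp only [endpoint_append, endpoint_cons] at hc
  refine ⟨s₂ ++ (s₁ ++ [(ε, b)]), by simp, ?_, ?_⟩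
  · simp only [edgeList_append, edgeList_cons, edgeList_nil, hc]
    refine List.perm_append_comm.trans ?_
    simp
  · ext x
    have ha : a ∈ (s₁ ++ (ε, b) :: s₂).map Prod.snd := by
      have := endpoint_mem a (s := s₁ ++ (ε, b) :: s₂) (by simp)
      simpa only [endpoint_append, endpoint_cons, hc] using this
    simp only [mem_vertices, List.map_append, List.map_cons, List.mem_append,
      List.mem_cons, List.map_nil, List.not_mem_nil] at ha ⊢
    constructor
    · rintro (h | h | h | h | h)
      all_goals tauto
    · rintro (h | h | h | h)
      · subst h; tauto
      all_goals tauto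

lemma NoSimple.perm {α : Type*} [BEq α] [LawfulBEq α] {l l' : List α} (h : NoSimple l)
    (hp : l.Perm l') : NoSimple l' := fun x hx => by
  rw [← hp.count_eq]; exact h x (hp.mem_iff.2 hx)

/-- Two closed walks of the same length with unbalanced letters, without simple positions when taken
together, have few vertices. -/
theorem card_vertices_union_le {a b : V} {s t : List (Bool × V)} (hs : endpoint a s = a)
    (ht : endpoint b t = b) (hst : s.length = t.length)
    (hns : NoSimple ((edgeList a s).map Prod.snd ++ (edgeList b t).map Prod.snd))
    (hws : (s.map Prod.fst).count true ≠ (s.map Prod.fst).count false)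
    (hwt : (t.map Prod.fst).count true ≠ (t.map Prod.fst).count false) :
    (vertices a s ∪ vertices b t).card ≤ s.length + 1 := by
  -- Disjoint walks share no position, so each is free of simple positions by itself; unbalanced
  -- letters then cost each walk half a vertex, one in total. Walks with a common vertex can both be
  -- started there and concatenated, and the general bound for length `2 * s.length` suffices.
  by_cases hd : Disjoint (vertices a s) (vertices b t)
  · have key : ∀ e ∈ (edgeList a s).map Prod.snd, e ∉ (edgeList b t).map Prod.snd := by
      intro e h1 h2
      obtain ⟨x, hx, rfl⟩ := List.mem_map.1 h1
      obtain ⟨y, hy, hxy⟩ := List.mem_map.1 h2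
      have h3 := (mem_vertices_of_mem_edgeList hx).1
      have h4 := (mem_vertices_of_mem_edgeList hy).1
      rw [hxy] at h4
      exact Finset.disjoint_left.1 hd (mem_vertices.2 (List.mem_cons.1 h3))
        (mem_vertices.2 (List.mem_cons.1 h4))
    have hn1 : NoSimple ((edgeList a s).map Prod.snd) := fun e he => by
      have := hns e (List.mem_append_left _ he)
      rwa [List.count_append, List.count_eq_zero.2 (key e he), add_zero] at this
    have hn2 : NoSimple ((edgeList b t).map Prod.snd) := fun e he => by
      have := hns e (List.mem_append_right _ he)
      rwa [List.count_append, List.count_eq_zero.2 (fun h => key e h he), zero_add] at this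
    have h1 := two_mul_card_vertices_lt hs hn1 hws
    have h2 := two_mul_card_vertices_lt ht hn2 hwt
    have := Finset.card_union_le (vertices a s) (vertices b t)
    omega
  · obtain ⟨u, hu1, hu2⟩ := Finset.not_disjoint_iff.1 hd
    obtain ⟨s', hs', hps, hvs⟩ := exists_rotation hs hu1
    obtain ⟨t', ht', hpt, hvt⟩ := exists_rotation ht hu2
    have hc : endpoint u (s' ++ t') = u := by rw [endpoint_append, hs', ht']
    have hn : NoSimple ((edgeList u (s' ++ t')).map Prod.snd) := by
      refine hns.perm ?_
      rw [edgeList_append, hs', List.map_append]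
      exact ((hps.map _).append (hpt.map _)).symm
    have h := two_mul_card_vertices_le hc hn
    have hv : vertices u (s' ++ t') = vertices a s ∪ vertices b t := by
      rw [← hvs, ← hvt]
      ext x
      simp only [mem_vertices, Finset.mem_union, List.map_append, List.mem_append]
      tauto
    have l1 := hps.length_eq
    have l2 := hpt.length_eq
    simp only [length_edgeList] at l1 l2
    rw [hv, List.length_append] at h
    omega

end Walks

/-! ### Walks given by vertex sequences, and tree walks. -/

section FinWalks

variable {V : Type*} {m : ℕ}

/-- The positions along the walk with vertices `i` and letters `w`. -/
def walkPosition (w : Fin m → Bool) (i : Fin (m + 1) → V) (l : Fin m) : V × V :=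
  position (w l) (i l.castSucc) (i l.succ)

/-- The steps of the walk with vertices `i` and letters `w`. -/
def walkSteps (w : Fin m → Bool) (i : Fin (m + 1) → V) : List (Bool × V) :=
  List.ofFn fun l => (w l, i l.succ)

lemma edgeList_walkSteps (w : Fin m → Bool) (i : Fin (m + 1) → V) :
    edgeList (i 0) (walkSteps w i) = List.ofFn fun l => (w l, walkPosition w i l) := by
  induction m with
  | zero => rfl
  | succ m ih =>
    have := ih (fun l => w l.succ) (fun l => i l.succ)
    simp only [walkSteps, walkPosition, List.ofFn_succ, edgeList_cons] at this ⊢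
    rw [List.cons.injEq]
    exact ⟨rfl, this⟩

lemma endpoint_walkSteps (w : Fin m → Bool) (i : Fin (m + 1) → V) :
    endpoint (i 0) (walkSteps w i) = i (Fin.last m) := by
  induction m with
  | zero => rfl
  | succ m ih =>
    have := ih (fun l => w l.succ) (fun l => i l.succ)
    simp only [walkSteps, List.ofFn_succ, endpoint_cons] at this ⊢
    exact this

@[simp] lemma length_walkSteps (w : Fin m → Bool) (i : Fin (m + 1) → V) :
    (walkSteps w i).length = m := by simp [walkSteps]

lemma map_fst_walkSteps (w : Fin m → Bool) (i : Fin (m + 1) → V) :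
    (walkSteps w i).map Prod.fst = List.ofFn w := by
  simp [walkSteps, List.map_ofFn, Function.comp_def]

lemma vertices_walkSteps [DecidableEq V] (w : Fin m → Bool) (i : Fin (m + 1) → V) :
    vertices (i 0) (walkSteps w i) = Finset.univ.image i := by
  ext x
  simp only [mem_vertices, walkSteps, List.map_ofFn, List.mem_ofFn, Finset.mem_image,
    Finset.mem_univ, true_and, Function.comp_def, Fin.exists_fin_succ (P := fun l => i l = x),
    eq_comm (a := x)]

lemma count_ofFn_bool (w : Fin m → Bool) (b : Bool) :
    (List.ofFn w).count b = Fintype.card {l // w l = b} := by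
  rw [Fintype.card_subtype, List.count, List.countP_eq_length_filter, ← List.length_map (f := id),
    Finset.card_def, Finset.filter_val, ← Multiset.countP_eq_card_filter]
  rw [List.length_map, ← List.countP_eq_length_filter, List.ofFn_eq_map, List.countP_map]
  have : (Finset.univ : Finset (Fin m)).val = (List.finRange m : Multiset (Fin m)) := rfl
  rw [this, Multiset.coe_countP]
  congr 1

/-- Some value of `e` is taken exactly once. -/
def IsSimple {ι α : Type*} (e : ι → α) : Prop := ∃ l, ∀ l', e l' = e l → l' = l

lemma noSimple_ofFn {α : Type*} [BEq α] [LawfulBEq α] {e : Fin m → α} (h : ¬ IsSimple e) :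
    NoSimple (List.ofFn e) := by
  classical
  intro x hx
  obtain ⟨l, rfl⟩ := List.mem_ofFn.1 hx
  simp only [IsSimple, not_exists, not_forall] at h
  obtain ⟨l', hl', hne⟩ := h l
  have : List.Duplicate (e l) (List.ofFn e) := by
    rw [List.duplicate_iff_exists_distinct_get]
    rcases lt_or_gt_of_ne hne with h | h
    · exact ⟨⟨l', by simp⟩, ⟨l, by simp⟩, by simpa using h, by simp [hl'], by simp⟩
    · exact ⟨⟨l, by simp⟩, ⟨l', by simp⟩, by simpa using h, by simp, by simp [hl']⟩
  rw [List.duplicate_iff_two_le_count] at this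
  convert this

lemma noSimple_append_ofFn {α : Type*} [BEq α] [LawfulBEq α] {e e' : Fin m → α}
    (h : ¬ IsSimple (Sum.elim e e')) : NoSimple (List.ofFn e ++ List.ofFn e') := by
  rw [← List.ofFn_fin_append]
  refine noSimple_ofFn fun ⟨l, hl⟩ => h ⟨finSumFinEquiv.symm l, fun l' hl' => ?_⟩
  have key : ∀ x, Fin.append e e' x = Sum.elim e e' (finSumFinEquiv.symm x) := fun x => by
    obtain ⟨y, rfl⟩ := finSumFinEquiv.surjective x
    rw [Equiv.symm_apply_apply]
    rcases y with y | y
    · rw [finSumFinEquiv_apply_left, Fin.append_left, Sum.elim_inl]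
    · rw [finSumFinEquiv_apply_right, Fin.append_right, Sum.elim_inr]
  have := hl (finSumFinEquiv l') (by rw [key, key, Equiv.symm_apply_apply, hl'])
  rw [← this, Equiv.symm_apply_apply]

/-- The closed walks `i` along `w` that run around a plane tree. -/
def IsTreeWalk (w : Fin m → Bool) (i : Fin (m + 1) → V) : Prop :=
  i 0 = i (Fin.last m) ∧ ¬ IsSimple (walkPosition w i) ∧ m + 2 ≤ 2 * (Set.range i).ncard

lemma ncard_range_eq [DecidableEq V] (i : Fin (m + 1) → V) :
    (Set.range i).ncard = (Finset.univ.image i).card := by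
  rw [← Set.ncard_coe_finset]; simp

lemma noSimple_walk [DecidableEq V] {w : Fin m → Bool} {i : Fin (m + 1) → V}
    (h : ¬ IsSimple (walkPosition w i)) :
    NoSimple ((edgeList (i 0) (walkSteps w i)).map Prod.snd) := by
  rw [edgeList_walkSteps, List.map_ofFn]
  exact noSimple_ofFn h

lemma IsTreeWalk.isDoubledTree {w : Fin m → Bool} {i : Fin (m + 1) → V} (h : IsTreeWalk w i) :
    2 * (Set.range i).ncard = m + 2 ∧ IsDoubledTree (i 0) (walkSteps w i) := by
  classical
  have hc : endpoint (i 0) (walkSteps w i) = i 0 := by rw [endpoint_walkSteps, h.1]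
  have := isDoubledTree_of_card hc (noSimple_walk h.2.1)
    (by rw [vertices_walkSteps, ← ncard_range_eq, length_walkSteps]; exact h.2.2)
  rwa [vertices_walkSteps, ← ncard_range_eq, length_walkSteps] at this

lemma IsTreeWalk.balanced {w : Fin m → Bool} {i : Fin (m + 1) → V} (h : IsTreeWalk w i) :
    Fintype.card {l // w l = true} = Fintype.card {l // w l = false} := by
  have := h.isDoubledTree.2.count_eq
  rwa [map_fst_walkSteps, count_ofFn_bool, count_ofFn_bool] at this

lemma walkPosition_comp {U : Type*} (w : Fin m → Bool) (i : Fin (m + 1) → V) (f : V → U)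
    (l : Fin m) : walkPosition w (f ∘ i) l = Prod.map f f (walkPosition w i l) := by
  cases h : w l <;> simp [walkPosition, position, h]

/-- This makes the tree property depend only on the kernel of `i`, so that tree walks fall into
finitely many shapes independent of `n`. -/
lemma isTreeWalk_comp_iff {U : Type*} (w : Fin m → Bool) (i : Fin (m + 1) → V) {f : V → U}
    (hf : f.Injective) : IsTreeWalk w (f ∘ i) ↔ IsTreeWalk w i := by
  have h1 : IsSimple (walkPosition w (f ∘ i)) ↔ IsSimple (walkPosition w i) := by
    simp only [IsSimple, walkPosition_comp, (hf.prodMap hf).eq_iff]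
  rw [IsTreeWalk, IsTreeWalk, h1, Set.range_comp, Set.ncard_image_of_injective _ hf]
  simp [hf.eq_iff]

/-- Two closed walks with the same unbalanced letters and without common simple position. -/
lemma ncard_range_elim_le {w : Fin m → Bool} {i j : Fin (m + 1) → V}
    (hw : Fintype.card {l // w l = true} ≠ Fintype.card {l // w l = false})
    (hi : i 0 = i (Fin.last m)) (hj : j 0 = j (Fin.last m))
    (h : ¬ IsSimple (Sum.elim (walkPosition w i) (walkPosition w j))) :
    (Set.range (Sum.elim i j)).ncard ≤ m + 1 := by
  classical
  have key := card_vertices_union_le (a := i 0) (b := j 0) (s := walkSteps w i)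
    (t := walkSteps w j) (by rw [endpoint_walkSteps, hi]) (by rw [endpoint_walkSteps, hj])
    (by simp)
    (by
      rw [edgeList_walkSteps, edgeList_walkSteps, List.map_ofFn, List.map_ofFn]
      exact noSimple_append_ofFn h)
    (by rwa [map_fst_walkSteps, count_ofFn_bool, count_ofFn_bool])
    (by rwa [map_fst_walkSteps, count_ofFn_bool, count_ofFn_bool])
  rw [vertices_walkSteps, vertices_walkSteps, length_walkSteps, ← Set.ncard_coe_finset] at key
  rw [Set.Sum.elim_range]
  simpa using key

end FinWalks

/-! ### Traces of words as sums over closed walks, and the expansion of `H(z) ^ k`. -/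

section Trace

variable {n : ℕ} {m : ℕ}

lemma ofFn_prod_apply {ι R : Type*} [Fintype ι] [DecidableEq ι] [CommRing R]
    (Y : Fin m → Matrix ι ι R) (a b : ι) :
    (List.ofFn Y).prod a b = ∑ i : Fin (m + 1) → ι,
      if i 0 = a ∧ i (Fin.last m) = b then ∏ l : Fin m, Y l (i l.castSucc) (i l.succ) else 0 := by
  induction m generalizing a with
  | zero =>
    rw [Fintype.sum_equiv (Equiv.funUnique (Fin 1) ι) _
      (fun c => if c = a ∧ c = b then (1 : R) else 0)
      (fun i => by simp [Fin.last])]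
    simp [Matrix.one_apply, ite_and]
  | succ m ih =>
    rw [List.ofFn_succ, List.prod_cons, Matrix.mul_apply]
    rw [← (Fin.consEquiv (fun _ : Fin (m + 2) => ι)).sum_comp, Fintype.sum_prod_type]
    simp only [ih, Finset.mul_sum]
    refine Finset.sum_comm.trans (.trans (Finset.sum_congr rfl fun i _ => ?_) Finset.sum_comm)
    simp only [Fin.consEquiv, Equiv.coe_fn_mk, Fin.cons_zero, Fin.prod_univ_succ, Fin.cons_succ,
      Fin.castSucc_zero, ← Fin.succ_castSucc, ← Fin.succ_last, ite_and, mul_ite, mul_zero,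
      Finset.sum_ite_eq, Finset.sum_ite_eq', Finset.mem_univ, if_true]

/-- An entry of `A` or of the entrywise conjugate of `A`. -/
def entry (ε : Bool) (A : Matrix (Fin n) (Fin n) ℂ) (p : Fin n × Fin n) : ℂ :=
  if ε then A p.1 p.2 else conj (A p.1 p.2)

/-- The factor `A` or `Aᴴ`. -/
def letter (A : Matrix (Fin n) (Fin n) ℂ) (ε : Bool) : Matrix (Fin n) (Fin n) ℂ :=
  if ε then A else Aᴴ

lemma letter_apply (A : Matrix (Fin n) (Fin n) ℂ) (ε : Bool) (a b : Fin n) :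
    letter A ε a b = entry ε A (position ε a b) := by
  cases ε <;> simp [letter, entry, position, Matrix.conjTranspose_apply]

lemma trace_word (A : Matrix (Fin n) (Fin n) ℂ) (w : Fin m → Bool) :
    (List.ofFn fun l => letter A (w l)).prod.trace =
      ∑ i : Fin (m + 1) → Fin n, if i 0 = i (Fin.last m) then
        ∏ l, entry (w l) A (walkPosition w i l) else 0 := by
  simp only [Matrix.trace, Matrix.diag, ofFn_prod_apply]
  rw [Finset.sum_comm]
  refine Finset.sum_congr rfl fun i _ => ?_
  simp only [ite_and, Finset.sum_ite_eq, Finset.mem_univ, if_true, letter_apply, walkPosition,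
    eq_comm (a := i (Fin.last m))]

lemma prod_letter_smul (s : ℝ) (A : Matrix (Fin n) (Fin n) ℂ) (w : List Bool) :
    (w.map (letter ((s : ℂ) • A))).prod = (s : ℂ) ^ w.length • (w.map (letter A)).prod := by
  induction w with
  | nil => simp
  | cons b w ih =>
    have : letter ((s : ℂ) • A) b = (s : ℂ) • letter A b := by
      cases b <;> simp [letter, Matrix.conjTranspose_smul]
    rw [List.map_cons, List.prod_cons, ih, this, List.map_cons, List.prod_cons, List.length_cons,
      smul_mul_smul_comm, pow_succ']

/-- The words in the expansion of `((X - z) (X - z)ᴴ) ^ k`, with the exponents of `-z` and of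
`-conj z`. -/
def expansion : ℕ → List (ℕ × ℕ × List Bool)
  | 0 => [(0, 0, [])]
  | k + 1 => (expansion k).flatMap fun t =>
      [(t.1, t.2.1, t.2.2 ++ [true, false]), (t.1, t.2.1 + 1, t.2.2 ++ [true]),
        (t.1 + 1, t.2.1, t.2.2 ++ [false]), (t.1 + 1, t.2.1 + 1, t.2.2)]

/-- Each of the `k` factors `X - z` supplies `X` or `-z`, and likewise for the adjoint factors.
Hence balanced letters mean equal exponents of `-z` and `-conj z`. -/
lemma expansion_count {k : ℕ} {t : ℕ × ℕ × List Bool} (ht : t ∈ expansion k) :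
    t.1 + t.2.2.count true = k ∧ t.2.1 + t.2.2.count false = k := by
  induction k generalizing t with
  | zero => simp only [expansion, List.mem_singleton] at ht; subst ht; simp
  | succ k ih =>
    simp only [expansion, List.mem_flatMap, List.mem_cons, List.not_mem_nil, or_false] at ht
    obtain ⟨u, hu, ht⟩ := ht
    have := ih hu
    rcases ht with rfl | rfl | rfl | rfl <;> simp <;> omega

lemma sub_mul_conjTranspose_pow (X : Matrix (Fin n) (Fin n) ℂ) (z : ℂ) (k : ℕ) :
    ((X - z • (1 : Matrix (Fin n) (Fin n) ℂ)) * (X - z • (1 : Matrix (Fin n) (Fin n) ℂ))ᴴ) ^ k =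
      ((expansion k).map fun t =>
        ((-z) ^ t.1 * (-conj z) ^ t.2.1) • (t.2.2.map (letter X)).prod).sum := by
  induction k with
  | zero => simp [expansion]
  | succ k ih =>
    rw [pow_succ, ih, expansion, ← List.sum_map_mul_right, List.map_flatMap, List.flatMap_def,
      List.sum_flatten, List.map_map]
    congr 1
    refine List.map_congr_left fun t _ => ?_
    simp only [Function.comp, List.map_cons, List.map_nil, List.map_append, List.prod_append,
      List.sum_cons, List.sum_nil,
      List.prod_cons, List.prod_nil, letter, Matrix.conjTranspose_sub,
      Matrix.conjTranspose_smul, Matrix.conjTranspose_one]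
    simp only [if_true, Bool.false_eq_true, if_false, mul_one, add_zero, pow_succ, mul_sub, sub_mul,
      smul_mul_assoc, mul_smul_comm, one_mul, smul_smul, mul_assoc, smul_sub, mul_neg,
      neg_mul, neg_smul, neg_neg]
    simp only [Complex.star_def]
    module

lemma hermitized_pow_trace (A : Matrix (Fin n) (Fin n) ℂ) (z : ℂ) (k : ℕ) :
    (hermitized A z ^ k).trace = ((expansion k).map fun t =>
      ((-z) ^ t.1 * (-conj z) ^ t.2.1) * ((((√n)⁻¹ : ℝ) : ℂ) ^ t.2.2.length *
        (t.2.2.map (letter A)).prod.trace)).sum := by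
  rw [hermitized, ← Complex.ofReal_inv, sub_mul_conjTranspose_pow, Matrix.trace_list_sum,
    List.map_map]
  congr 1
  refine List.map_congr_left fun t _ => ?_
  simp only [Function.comp, prod_letter_smul, Matrix.trace_smul, smul_eq_mul]

end Trace

@[simp] lemma norm_entry {n : ℕ} (ε : Bool) (A : Matrix (Fin n) (Fin n) ℂ) (p : Fin n × Fin n) :
    ‖entry ε A p‖ = ‖A p.1 p.2‖ := by
  cases ε <;> simp [entry]

/-! ### Elementary counting and product bounds. -/

section Counting

/-- A map with at most `r` values factors through `Fin r`; the bound counts the pairs of factors. -/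
lemma card_ncard_range_le {κ : Type*} [Fintype κ] [DecidableEq κ] [Nonempty κ] (n r : ℕ) :
    Nat.card {i : κ → Fin n // (Set.range i).ncard ≤ r} ≤ r ^ Fintype.card κ * n ^ r := by
  classical
  have hsurj : ∀ i : {i : κ → Fin n // (Set.range i).ncard ≤ r},
      ∃ p : (κ → Fin r) × (Fin r → Fin n), p.2 ∘ p.1 = i.1 := by
    rintro ⟨i, hi⟩
    have hcard : Fintype.card (Set.range i) ≤ Fintype.card (Fin r) := by
      rwa [Fintype.card_fin, ← Nat.card_eq_fintype_card]
    obtain ⟨e⟩ := Function.Embedding.nonempty_of_card_le hcard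
    -- Off the image of `e` the value is irrelevant; some value of `i` serves as the default.
    refine ⟨⟨fun x => e ⟨i x, x, rfl⟩,
      Function.extend e Subtype.val fun _ => i (Classical.arbitrary κ)⟩, ?_⟩
    ext1 x
    exact e.injective.extend_apply Subtype.val (fun _ => i (Classical.arbitrary κ)) ⟨i x, x, rfl⟩
  choose g hg using hsurj
  have hinj : Function.Injective g := fun i j hij => Subtype.ext (by rw [← hg i, ← hg j, hij])
  refine (Nat.card_le_card_of_injective g hinj).trans ?_
  simp

/-- Sorts the letters into the layout of the moment tensor, with the unconjugated slots on the left.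
-/
lemma exists_equiv_of_balanced {ι : Type*} [Fintype ι] {W : ι → Bool} {k : ℕ}
    (ht : Fintype.card {l // W l = true} = k) (hf : Fintype.card {l // W l = false} = k) :
    ∃ σ : Fin k ⊕ Fin k ≃ ι, (∀ s, W (σ (.inl s)) = true) ∧ ∀ s, W (σ (.inr s)) = false := by
  have e1 := (Fintype.equivFinOfCardEq ht).symm
  have e2 := (Fintype.equivFinOfCardEq hf).symm
  have e3 : {l // W l = false} ≃ {l // ¬ W l = true} :=
    Equiv.subtypeEquivRight fun l => by simp
  refine ⟨(e1.sumCongr (e2.trans e3)).trans (Equiv.sumCompl _), fun s => ?_, fun s => ?_⟩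
  · simpa using (e1 s).2
  · have := (e3 (e2 s)).2
    simpa using this

/-- Every factor is at most the largest one; the summand `1` covers the empty product. Mixed moments
are thereby reduced to moments of single entries, which (A1) bounds. -/
lemma prod_le_one_add_sum_pow {ι : Type*} [Fintype ι] {a : ι → ℝ} (ha : ∀ l, 0 ≤ a l) :
    ∏ l, a l ≤ 1 + ∑ l, a l ^ Fintype.card ι := by
  classical
  rcases isEmpty_or_nonempty ι with h | h
  · simp
  · obtain ⟨x, -, hx⟩ := Finset.exists_max_image Finset.univ a Finset.univ_nonempty
    have h1 : ∏ l, a l ≤ a x ^ Fintype.card ι := by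
      refine (Finset.prod_le_prod (fun l _ => ha l) fun l hl => hx l hl).trans ?_
      simp
    have h2 : a x ^ Fintype.card ι ≤ ∑ l, a l ^ Fintype.card ι :=
      Finset.single_le_sum (f := fun l => a l ^ Fintype.card ι)
        (fun l _ => pow_nonneg (ha l) _) (Finset.mem_univ x)
    linarith

end Counting

/-! ### Uniform moment bounds and negligible terms. -/

section Moments

variable {Ω : ℕ → Type*} [∀ n, MeasurableSpace (Ω n)] {P : ∀ n, Measure (Ω n)}
  {A : ∀ n, Ω n → Matrix (Fin n) (Fin n) ℂ}

lemma measurable_entry (hA : ∀ n i j, Measurable fun ω => A n ω i j) (n : ℕ) (ε : Bool)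
    (p : Fin n × Fin n) : Measurable fun ω => entry ε (A n ω) p := by
  cases ε
  · simpa [entry, Function.comp_def] using Complex.continuous_conj.measurable.comp (hA n p.1 p.2)
  · simpa [entry] using hA n p.1 p.2

lemma exists_moment_bound (hA : ∀ n i j, Measurable fun ω => A n ω i j)
    (h1 : AssumptionA1 P A) (k : ℕ) :
    ∃ C : ℝ, 0 ≤ C ∧ ∀ n i j, Integrable (fun ω => ‖A n ω i j‖ ^ k) (P n) ∧
      ∫ ω, ‖A n ω i j‖ ^ k ∂(P n) ≤ C := by
  have hS := h1 k
  set S := ⨆ n : ℕ, ⨆ i : Fin n, ⨆ j : Fin n, ∫⁻ ω, ‖A n ω i j‖ₑ ^ k ∂(P n) with hSdef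
  refine ⟨S.toReal, ENNReal.toReal_nonneg, fun n i j => ?_⟩
  have hle : ∫⁻ ω, ‖A n ω i j‖ₑ ^ k ∂(P n) ≤ S :=
    le_iSup_of_le n (le_iSup_of_le i (le_iSup_of_le j le_rfl))
  have hmeas : AEStronglyMeasurable (fun ω => ‖A n ω i j‖ ^ k) (P n) :=
    ((hA n i j).norm.pow_const k).aestronglyMeasurable
  refine ⟨⟨hmeas, ?_⟩, ?_⟩
  · rw [hasFiniteIntegral_iff_enorm]
    simp only [enorm_pow, enorm_norm]
    exact hle.trans_lt hS
  · rw [integral_eq_lintegral_of_nonneg_ae (ae_of_all _ fun ω => by positivity) hmeas]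
    refine ENNReal.toReal_mono hS.ne (le_trans (le_of_eq ?_) hle)
    refine lintegral_congr fun ω => ?_
    rw [ENNReal.ofReal_pow (norm_nonneg _), ofReal_norm]

/-- The product of the entries at the positions `e l`, conjugated where `W l = false`. -/
def monomial {n : ℕ} {ι : Type*} [Fintype ι] (W : ι → Bool) (e : ι → Fin n × Fin n)
    (B : Matrix (Fin n) (Fin n) ℂ) : ℂ := ∏ l, entry (W l) B (e l)

lemma norm_monomial {n : ℕ} {ι : Type*} [Fintype ι] (W : ι → Bool) (e : ι → Fin n × Fin n)
    (B : Matrix (Fin n) (Fin n) ℂ) : ‖monomial W e B‖ = ∏ l, ‖B (e l).1 (e l).2‖ := by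
  simp [monomial]

/-- The terms with a simple position are controlled by the moment tensor. -/
lemma sum_simple_le {ι κ : Type*} [Fintype ι] {W : ι → Bool}
    {k : ℕ} (ht : Fintype.card {l // W l = true} = k)
    (hf : Fintype.card {l // W l = false} = k) (q : ι → κ × κ)
    (hq : Nonempty ι → ∀ x, ∃ l, (q l).1 = x ∨ (q l).2 = x) (n : ℕ) (D : Finset (κ → Fin n))
    (hD : ∀ i ∈ D, IsSimple fun l => Prod.map i i (q l)) :
    ∑ i ∈ D, ‖∫ ω, monomial W (fun l => Prod.map i i (q l)) (A n ω) ∂(P n)‖ ≤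
      simpleMomentSum (P n) (A n) k := by
  classical
  obtain ⟨σ, hσt, hσf⟩ := exists_equiv_of_balanced ht hf
  -- `Φ i` is the multi-index of the tensor entry belonging to `i`. A simple position makes `ι`
  -- nonempty, and then `hq` says that every vertex lies on some step; so `Φ` is injective on `D`
  -- and no tensor entry is counted twice.
  let Φ : (κ → Fin n) → (Fin k ⊕ Fin k → Fin n) × (Fin k ⊕ Fin k → Fin n) :=
    fun i => (fun s => i (q (σ s)).1, fun s => i (q (σ s)).2)
  have hΦ : Set.InjOn Φ D := by
    intro i hi j hj hij
    obtain ⟨l, -⟩ := hD i hi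
    ext1 x
    obtain ⟨l, hl⟩ := hq ⟨l⟩ x
    have h1 := congrFun (congrArg Prod.fst hij) (σ.symm l)
    have h2 := congrFun (congrArg Prod.snd hij) (σ.symm l)
    simp only [Φ, Equiv.apply_symm_apply] at h1 h2
    rcases hl with rfl | rfl
    · exact h1
    · exact h2
  have hterm : ∀ i, momentEntry (P n) (A n) k (Φ i).1 (Φ i).2 =
      ∫ ω, monomial W (fun l => Prod.map i i (q l)) (A n ω) ∂(P n) := by
    intro i
    refine integral_congr_ae (ae_of_all _ fun ω => ?_)
    simp only [monomial]
    rw [← σ.prod_comp, Fintype.prod_sum_type]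
    simp [hσt, hσf, entry, Φ]
  have hsimple : ∀ i ∈ D, HasSimplePosition (Φ i).1 (Φ i).2 := by
    intro i hi
    obtain ⟨l, hl⟩ := hD i hi
    refine ⟨σ.symm l, fun s hs => ?_⟩
    rw [← hl (σ s) (by simpa [Φ, Prod.map] using hs), Equiv.symm_apply_apply]
  rw [simpleMomentSum, ← Fintype.sum_prod_type'
    (f := fun r c => if HasSimplePosition r c then ‖momentEntry (P n) (A n) k r c‖ else 0)]
  calc ∑ i ∈ D, ‖∫ ω, monomial W (fun l => Prod.map i i (q l)) (A n ω) ∂(P n)‖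
      = ∑ i ∈ D, if HasSimplePosition (Φ i).1 (Φ i).2 then
          ‖momentEntry (P n) (A n) k (Φ i).1 (Φ i).2‖ else 0 :=
        Finset.sum_congr rfl fun i hi => by rw [if_pos (hsimple i hi), hterm]
    _ = ∑ p ∈ D.image Φ, if HasSimplePosition p.1 p.2 then
          ‖momentEntry (P n) (A n) k p.1 p.2‖ else 0 := by
        rw [Finset.sum_image hΦ]
    _ ≤ _ := Finset.sum_le_sum_of_subset_of_nonneg (Finset.subset_univ _) fun p _ _ => by
        split_ifs <;> positivity

variable [∀ n, IsProbabilityMeasure (P n)]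

/-- Products of a fixed number of entries have uniformly bounded expectations. -/
lemma exists_prod_bound (hA : ∀ n i j, Measurable fun ω => A n ω i j)
    (h1 : AssumptionA1 P A) (ι : Type*) [Fintype ι] :
    ∃ C : ℝ, 0 ≤ C ∧ ∀ n (e : ι → Fin n × Fin n),
      Integrable (fun ω => ∏ l, ‖A n ω (e l).1 (e l).2‖) (P n) ∧
      ∫ ω, ∏ l, ‖A n ω (e l).1 (e l).2‖ ∂(P n) ≤ C := by
  obtain ⟨C, hC, h⟩ := exists_moment_bound hA h1 (Fintype.card ι)
  refine ⟨1 + Fintype.card ι * C, by positivity, fun n e => ?_⟩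
  have hint : Integrable
      (fun ω => 1 + ∑ l, ‖A n ω (e l).1 (e l).2‖ ^ Fintype.card ι) (P n) :=
    (integrable_const _).add (integrable_finsetSum _ fun l _ => (h n _ _).1)
  have hle : ∀ ω, ∏ l, ‖A n ω (e l).1 (e l).2‖ ≤
      1 + ∑ l, ‖A n ω (e l).1 (e l).2‖ ^ Fintype.card ι := fun ω =>
    prod_le_one_add_sum_pow fun l => norm_nonneg _
  have hint2 : Integrable (fun ω => ∏ l, ‖A n ω (e l).1 (e l).2‖) (P n) := by
    refine hint.mono' ?_ (ae_of_all _ fun ω => ?_)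
    · exact (Finset.measurable_fun_prod _ fun l _ => (hA n _ _).norm).aestronglyMeasurable
    · rw [Real.norm_of_nonneg (Finset.prod_nonneg fun l _ => norm_nonneg _)]
      exact hle ω
  refine ⟨hint2, (integral_mono hint2 hint hle).trans ?_⟩
  rw [integral_add (integrable_const _) (integrable_finsetSum _ fun l _ => (h n _ _).1),
    integral_finsetSum _ fun l _ => (h n _ _).1]
  have : ∑ l, ∫ ω, ‖A n ω (e l).1 (e l).2‖ ^ Fintype.card ι ∂(P n) ≤ ∑ _l : ι, C :=
    Finset.sum_le_sum fun l _ => (h n _ _).2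
  simpa using this

lemma integrable_monomial (hA : ∀ n i j, Measurable fun ω => A n ω i j)
    (h1 : AssumptionA1 P A) {ι : Type*} [Fintype ι] (n : ℕ) (W : ι → Bool)
    (e : ι → Fin n × Fin n) : Integrable (fun ω => monomial W e (A n ω)) (P n) := by
  obtain ⟨C, -, h⟩ := exists_prod_bound hA h1 ι
  refine (h n e).1.mono' ?_ (ae_of_all _ fun ω => (norm_monomial W e _).le)
  exact (Finset.measurable_fun_prod _ fun l _ =>
    measurable_entry hA n (W l) (e l)).aestronglyMeasurable

/-- By (A1) the terms are uniformly bounded, and only `O(n ^ r)` index maps take at most `r` values.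
-/
lemma exists_sum_few_le (hA : ∀ n i j, Measurable fun ω => A n ω i j)
    (h1 : AssumptionA1 P A) {ι κ : Type*} [Fintype ι] [Fintype κ] [Nonempty κ] (W : ι → Bool)
    (q : ι → κ × κ) (r : ℕ) :
    ∃ C : ℝ, ∀ n (D : Finset (κ → Fin n)), (∀ i ∈ D, (Set.range i).ncard ≤ r) →
      ∑ i ∈ D, ‖∫ ω, monomial W (fun l => Prod.map i i (q l)) (A n ω) ∂(P n)‖ ≤
        C * (n : ℝ) ^ r := by
  classical
  obtain ⟨C, hC, h⟩ := exists_prod_bound hA h1 ι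
  refine ⟨C * r ^ Fintype.card κ, fun n D hD => ?_⟩
  have hterm : ∀ i ∈ D, ‖∫ ω, monomial W (fun l => Prod.map i i (q l)) (A n ω) ∂(P n)‖ ≤ C := by
    intro i _
    refine (norm_integral_le_integral_norm _).trans ?_
    simp only [norm_monomial]
    exact (h n _).2
  have hcard : D.card ≤ r ^ Fintype.card κ * n ^ r := by
    refine le_trans ?_ (card_ncard_range_le (κ := κ) n r)
    rw [Nat.card_eq_fintype_card, Fintype.card_subtype]
    exact Finset.card_le_card fun i hi => by simpa using hD i hi
  calc _ ≤ D.card • C := Finset.sum_le_card_nsmul _ _ _ hterm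
    _ = (D.card : ℝ) * C := nsmul_eq_mul _ _
    _ ≤ ((r ^ Fintype.card κ * n ^ r : ℕ) : ℝ) * C := by gcongr
    _ = _ := by push_cast; ring

/-- Terms that have a simple position or few vertices are negligible. -/
lemma exists_sum_le (hA : ∀ n i j, Measurable fun ω => A n ω i j)
    (h1 : AssumptionA1 P A) {ι κ : Type*} [Fintype ι] [Fintype κ] [Nonempty κ] {W : ι → Bool}
    {k : ℕ} (ht : Fintype.card {l // W l = true} = k)
    (hf : Fintype.card {l // W l = false} = k) (q : ι → κ × κ)
    (hq : Nonempty ι → ∀ x, ∃ l, (q l).1 = x ∨ (q l).2 = x) (r : ℕ) :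
    ∃ C : ℝ, ∀ n (D : Finset (κ → Fin n)),
      (∀ i ∈ D, ¬ IsSimple (fun l => Prod.map i i (q l)) → (Set.range i).ncard ≤ r) →
      ∑ i ∈ D, ‖∫ ω, monomial W (fun l => Prod.map i i (q l)) (A n ω) ∂(P n)‖ ≤
        simpleMomentSum (P n) (A n) k + C * (n : ℝ) ^ r := by
  classical
  obtain ⟨C, hC⟩ := exists_sum_few_le hA h1 W q r
  refine ⟨C, fun n D hD => ?_⟩
  rw [← Finset.sum_filter_add_sum_filter_not D fun i => IsSimple fun l => Prod.map i i (q l)]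
  refine add_le_add (sum_simple_le ht hf q hq n _ fun i hi => (Finset.mem_filter.1 hi).2)
    (hC n _ fun i hi => ?_)
  rw [Finset.mem_filter] at hi
  exact hD i hi.1 hi.2

end Moments

/-! ### Averaging over vertex labels, line averages, and a truncation inequality. -/

section Averaging

variable {V : Type*} [Fintype V] [DecidableEq V] {n : ℕ}

/-- Exchanging the label `f b` with the fresh label `j` is an involution of the pairs `(f, j)`. This
is how the label of a leaf gets summed out. -/
lemma sum_sum_update {E : Type*} [AddCommMonoid E] (F : (V → Fin n) → E) (b : V) :
    ∑ f, ∑ j, F (Function.update f b j) = n • ∑ f, F f := by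
  let e : (V → Fin n) × Fin n ≃ (V → Fin n) × Fin n :=
    { toFun := fun p => (Function.update p.1 b p.2, p.1 b)
      invFun := fun p => (Function.update p.1 b p.2, p.1 b)
      left_inv := fun p => by simp
      right_inv := fun p => by simp }
  rw [← Fintype.sum_prod_type' (f := fun f j => F (Function.update f b j)),
    show ∑ p : (V → Fin n) × Fin n, F (Function.update p.1 b p.2) = ∑ p, F (e p).1 from rfl,
    e.sum_comp (fun p => F p.1), Fintype.sum_prod_type]
  simp [Finset.sum_nsmul]

lemma sum_eval (h : Fin n → ℝ) (u : V) :
    (n : ℝ) * ∑ f : V → Fin n, h (f u) = (n : ℝ) ^ Fintype.card V * ∑ i, h i := by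
  have := sum_sum_update (fun f : V → Fin n => h (f u)) u
  simp only [Function.update_self, Finset.sum_const, nsmul_eq_mul] at this
  rw [← this]
  simp

end Averaging

/-- The product of the entries at the listed positions, conjugated at the letter `false`. -/
def listWeight {n : ℕ} (K : List (Bool × (Fin n × Fin n))) (B : Matrix (Fin n) (Fin n) ℂ) : ℂ :=
  (K.map fun x => entry x.1 B x.2).prod

@[simp] lemma listWeight_append {n : ℕ} (K L : List (Bool × (Fin n × Fin n)))
    (B : Matrix (Fin n) (Fin n) ℂ) :
    listWeight (K ++ L) B = listWeight K B * listWeight L B := by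
  simp [listWeight]

@[simp] lemma listWeight_cons {n : ℕ} (x : Bool × (Fin n × Fin n))
    (L : List (Bool × (Fin n × Fin n))) (B : Matrix (Fin n) (Fin n) ℂ) :
    listWeight (x :: L) B = entry x.1 B x.2 * listWeight L B := by
  simp [listWeight]

@[simp] lemma listWeight_nil {n : ℕ} (B : Matrix (Fin n) (Fin n) ℂ) :
    listWeight [] B = 1 := by
  simp [listWeight]

/-- The normalized squared norm of the row (`ε = true`) or column (`ε = false`) `i`. -/
noncomputable def lineAverage {n : ℕ} (ε : Bool) (B : Matrix (Fin n) (Fin n) ℂ) (i : Fin n) : ℝ :=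
  (1 / (n : ℝ)) * ∑ j : Fin n, ‖B (position ε i j).1 (position ε i j).2‖ ^ 2

lemma lineAverage_nonneg {n : ℕ} (ε : Bool) (B : Matrix (Fin n) (Fin n) ℂ) (i : Fin n) :
    0 ≤ lineAverage ε B i := by
  unfold lineAverage; positivity

/-- Replaces every vertex of a walk by its image under `f`. -/
def relabel {V : Type*} {n : ℕ} (f : V → Fin n) (L : List (Bool × (V × V))) :
    List (Bool × (Fin n × Fin n)) := L.map (Prod.map id (Prod.map f f))

lemma relabel_update {V : Type*} [DecidableEq V] {n : ℕ} (f : V → Fin n) {a b : V} (j : Fin n)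
    {s : List (Bool × V)} (hab : b ≠ a) (hs : b ∉ s.map Prod.snd) :
    relabel (Function.update f b j) (edgeList a s) = relabel f (edgeList a s) := by
  refine List.map_congr_left fun x hx => ?_
  obtain ⟨h1, h2⟩ := mem_vertices_of_mem_edgeList hx
  have hb : b ∉ a :: s.map Prod.snd := by simp only [List.mem_cons, not_or]; exact ⟨hab, hs⟩
  have h3 : x.2.1 ≠ b := fun h => hb (h ▸ h1)
  have h4 : x.2.2 ≠ b := fun h => hb (h ▸ h2)
  simp [Prod.map, Function.update_of_ne h3, Function.update_of_ne h4]

/-- Here `c` stands for the indicator of a deviation of at least `δ`. Small deviations give `δ * g`;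
for large ones, `x ≤ δ * x ^ 2 + δ⁻¹` is applied to `x = g * |r - 1|`, with `(r - 1) ^ 2 ≤ r ^ 2 +
1`. After integration, convergence in probability and bounded second moments give convergence in
mean. -/
lemma norm_mul_abs_le {δ g r : ℝ} (hδ : 0 < δ) (hg : 0 ≤ g) (hr : 0 ≤ r) (c : ℝ)
    (hc0 : 0 ≤ c) (hc : δ ≤ |r - 1| → c = 1) :
    g * |r - 1| ≤ δ * g + δ * (g ^ 2 * r ^ 2 + g ^ 2) + δ⁻¹ * c := by
  rcases le_or_gt δ |r - 1| with h | h
  · rw [hc h, mul_one]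
    set x := g * |r - 1| with hx
    have h1 : x ^ 2 ≤ g ^ 2 * r ^ 2 + g ^ 2 := by
      rw [hx, mul_pow, sq_abs]
      nlinarith [mul_nonneg (sq_nonneg g) hr]
    have h2 : x ≤ δ * x ^ 2 + δ⁻¹ := by
      have h3 : δ * x ^ 2 + δ⁻¹ - x = δ * (x - δ⁻¹ / 2) ^ 2 + 3 / 4 * δ⁻¹ := by
        field_simp; ring
      have : 0 ≤ δ * (x - δ⁻¹ / 2) ^ 2 + 3 / 4 * δ⁻¹ := by positivity
      linarith
    have h4 : δ * x ^ 2 ≤ δ * (g ^ 2 * r ^ 2 + g ^ 2) := by gcongr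
    have h5 : 0 ≤ δ * g := by positivity
    linarith
  · have h1 : g * |r - 1| ≤ g * δ := by gcongr
    have h2 : 0 ≤ δ * (g ^ 2 * r ^ 2 + g ^ 2) := by positivity
    have h3 : 0 ≤ δ⁻¹ * c := by positivity
    linarith

/-! ### Every tree shape has limiting weight one. -/

section Trees

variable {Ω : ℕ → Type*} [∀ n, MeasurableSpace (Ω n)] {P : ∀ n, Measure (Ω n)}
  {A : ∀ n, Ω n → Matrix (Fin n) (Fin n) ℂ}

lemma measurable_listWeight (hA : ∀ n i j, Measurable fun ω => A n ω i j) (n : ℕ)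
    (K : List (Bool × (Fin n × Fin n))) : Measurable fun ω => listWeight K (A n ω) := by
  induction K with
  | nil => simp
  | cons x K ih => simpa using (measurable_entry hA n x.1 x.2).fun_mul ih

lemma measurable_lineAverage (hA : ∀ n i j, Measurable fun ω => A n ω i j) (n : ℕ) (ε : Bool)
    (i : Fin n) : Measurable fun ω => lineAverage ε (A n ω) i :=
  (Finset.measurable_fun_sum _ fun _ _ => (hA n _ _).norm.pow_const 2).const_mul _

lemma AssumptionA3.tendsto (h3 : AssumptionA3 P A) (ε : Bool) {δ : ℝ} (hδ : 0 < δ) :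
    Tendsto (fun n : ℕ => (1 / (n : ℝ)) * ∑ i : Fin n,
      (P n).real {ω | δ ≤ |lineAverage ε (A n ω) i - 1|}) atTop (𝓝 0) := by
  cases ε
  · exact (h3 δ hδ).2
  · exact (h3 δ hδ).1

variable [∀ n, IsProbabilityMeasure (P n)]

lemma exists_list_bound (hA : ∀ n i j, Measurable fun ω => A n ω i j)
    (h1 : AssumptionA1 P A) (N : ℕ) :
    ∃ C : ℝ, 0 ≤ C ∧ ∀ n (K : List (Bool × (Fin n × Fin n))), K.length = N →
      Integrable (fun ω => ‖listWeight K (A n ω)‖) (P n) ∧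
      ∫ ω, ‖listWeight K (A n ω)‖ ∂(P n) ≤ C := by
  obtain ⟨C, hC, h⟩ := exists_prod_bound hA h1 (Fin N)
  refine ⟨C, hC, fun n K hK => ?_⟩
  subst hK
  have : ∀ ω, ‖listWeight K (A n ω)‖ =
      ∏ l : Fin K.length, ‖A n ω (K.get l).2.1 (K.get l).2.2‖ := by
    intro ω
    rw [listWeight, ← Fin.prod_univ_fun_getElem, norm_prod]
    simp
  simp only [this]
  exact h n fun l => (K.get l).2

lemma integrable_listWeight (hA : ∀ n i j, Measurable fun ω => A n ω i j)
    (h1 : AssumptionA1 P A) (n : ℕ) (K : List (Bool × (Fin n × Fin n))) :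
    Integrable (fun ω => listWeight K (A n ω)) (P n) := by
  obtain ⟨C, -, h⟩ := exists_list_bound hA h1 K.length
  exact (integrable_norm_iff (measurable_listWeight hA n K).aestronglyMeasurable).1 (h n K rfl).1

/-- Second moments of products of entries, also when weighted by a squared line average. -/
lemma exists_sq_bound (hA : ∀ n i j, Measurable fun ω => A n ω i j)
    (h1 : AssumptionA1 P A) (N : ℕ) :
    ∃ C : ℝ, 0 ≤ C ∧ ∀ n (K : List (Bool × (Fin n × Fin n))) ε i, K.length = N →
      Integrable (fun ω => ‖listWeight K (A n ω)‖ ^ 2 * lineAverage ε (A n ω) i ^ 2) (P n) ∧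
      ∫ ω, ‖listWeight K (A n ω)‖ ^ 2 * lineAverage ε (A n ω) i ^ 2 ∂(P n) ≤ C := by
  obtain ⟨C, hC, h⟩ := exists_list_bound hA h1 (N + N + 4)
  refine ⟨C, hC, fun n K ε i hK => ?_⟩
  have hn : (n : ℝ) ≠ 0 := by
    have := i.pos
    positivity
  -- Only norms matter, so each squared norm is written as a repeated entry; expanding the squared
  -- line average gives products of `N + N + 4` entries, averaged over `j` and `j'`.
  let M : Fin n → Fin n → List (Bool × (Fin n × Fin n)) := fun j j' => K ++ K ++
    [(true, position ε i j), (true, position ε i j), (true, position ε i j'),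
      (true, position ε i j')]
  have hM : ∀ j j', (M j j').length = N + N + 4 := fun j j' => by simp [M, hK]; omega
  have hexp : ∀ ω, ‖listWeight K (A n ω)‖ ^ 2 * lineAverage ε (A n ω) i ^ 2 =
      ((n : ℝ) ^ 2)⁻¹ * ∑ j, ∑ j', ‖listWeight (M j j') (A n ω)‖ := by
    intro ω
    simp only [M, lineAverage, listWeight_append, listWeight_cons, listWeight_nil, norm_mul,
      norm_entry, mul_one]
    rw [mul_pow, sq (∑ j : Fin n, _), Finset.sum_mul_sum, Finset.mul_sum, Finset.mul_sum,
      Finset.mul_sum]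
    refine Finset.sum_congr rfl fun j _ => ?_
    rw [Finset.mul_sum, Finset.mul_sum, Finset.mul_sum]
    refine Finset.sum_congr rfl fun j' _ => ?_
    field_simp
  simp only [hexp]
  have hint : ∀ j j', Integrable (fun ω => ‖listWeight (M j j') (A n ω)‖) (P n) :=
    fun j j' => (h n _ (hM j j')).1
  refine ⟨(integrable_finsetSum _ fun j _ => integrable_finsetSum _ fun j' _ =>
    hint j j').const_mul _, ?_⟩
  rw [integral_const_mul, integral_finsetSum _ fun j _ =>
    integrable_finsetSum _ fun j' _ => hint j j']
  have : ∑ j, ∫ ω, ∑ j', ‖listWeight (M j j') (A n ω)‖ ∂(P n) ≤ ∑ _j : Fin n, ∑ _j' : Fin n, C := by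
    refine Finset.sum_le_sum fun j _ => ?_
    rw [integral_finsetSum _ fun j' _ => hint j j']
    exact Finset.sum_le_sum fun j' _ => (h n _ (hM j j')).2
  simp only [Finset.sum_const, Finset.card_univ, Fintype.card_fin, nsmul_eq_mul] at this
  calc _ ≤ ((n : ℝ) ^ 2)⁻¹ * (n * (n * C)) := by gcongr
    _ = C := by field_simp

/-- The error made by replacing a line average by one. -/
lemma exists_error_bound (hA : ∀ n i j, Measurable fun ω => A n ω i j)
    (h1 : AssumptionA1 P A) (N : ℕ) :
    ∃ C : ℝ, 0 ≤ C ∧ ∀ n (K : List (Bool × (Fin n × Fin n))) ε i, K.length = N → ∀ δ, 0 < δ →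
      ‖∫ ω, listWeight K (A n ω) * ((lineAverage ε (A n ω) i - 1 : ℝ) : ℂ) ∂(P n)‖ ≤
        δ * C + δ⁻¹ * (P n).real {ω | δ ≤ |lineAverage ε (A n ω) i - 1|} := by
  obtain ⟨C₁, hC₁, hb₁⟩ := exists_list_bound hA h1 N
  obtain ⟨C₂, hC₂, hb₂⟩ := exists_list_bound hA h1 (N + N)
  obtain ⟨C₃, hC₃, hb₃⟩ := exists_sq_bound hA h1 N
  refine ⟨C₁ + (C₃ + C₂), by positivity, fun n K ε i hK δ hδ => ?_⟩
  set S := {ω | δ ≤ |lineAverage ε (A n ω) i - 1|} with hS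
  have hSm : MeasurableSet S :=
    measurableSet_le measurable_const ((measurable_lineAverage hA n ε i).sub_const 1).abs
  have hKK := hb₂ n (K ++ K) (by simp [hK])
  simp only [listWeight_append, ← sq, norm_pow] at hKK
  have hK1 := hb₁ n K hK
  have hK3 := hb₃ n K ε i hK
  have hind : Integrable (S.indicator fun _ => (1 : ℝ)) (P n) :=
    (integrable_const 1).indicator hSm
  have hI2 := (hK3.1.add hKK.1).const_mul δ
  have hI1 := hK1.1.const_mul δ
  have hI3 := hind.const_mul δ⁻¹
  refine (norm_integral_le_integral_norm _).trans ?_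
  have hpt : ∀ ω, ‖listWeight K (A n ω) * ((lineAverage ε (A n ω) i - 1 : ℝ) : ℂ)‖ ≤
      δ * ‖listWeight K (A n ω)‖ + δ * (‖listWeight K (A n ω)‖ ^ 2 * lineAverage ε (A n ω) i ^ 2 +
        ‖listWeight K (A n ω)‖ ^ 2) + δ⁻¹ * S.indicator (fun _ => (1 : ℝ)) ω := by
    intro ω
    rw [norm_mul, Complex.norm_real, Real.norm_eq_abs]
    exact norm_mul_abs_le hδ (norm_nonneg _) (lineAverage_nonneg _ _ _) _
      (Set.indicator_nonneg (fun _ _ => zero_le_one) _)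
      fun h => Set.indicator_of_mem (s := S) h _
  refine (integral_mono_of_nonneg (ae_of_all _ fun ω => norm_nonneg _) ((hI1.add hI2).add hI3)
    (ae_of_all _ hpt)).trans ?_
  have e1 := integral_add (hI1.add hI2) hI3
  have e2 := integral_add hI1 hI2
  have e3 := integral_add hK3.1 hKK.1
  simp only [Pi.add_apply] at e1 e2 e3 ⊢
  rw [e1, e2, integral_const_mul, integral_const_mul, integral_const_mul, e3,
    integral_indicator_const _ hSm]
  have := hK1.2
  have := hK3.2
  have := hKK.2
  simp only [smul_eq_mul, mul_one]
  have : δ * (∫ ω, ‖listWeight K (A n ω)‖ ∂(P n)) ≤ δ * C₁ := by gcongr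
  have : δ * ((∫ ω, ‖listWeight K (A n ω)‖ ^ 2 * lineAverage ε (A n ω) i ^ 2 ∂(P n)) +
      ∫ ω, ‖listWeight K (A n ω)‖ ^ 2 ∂(P n)) ≤ δ * (C₃ + C₂) := by gcongr
  linarith


/-- Averaged over all labels `f`, the bound of `exists_error_bound` depends on `f u` only, so
`sum_eval` turns its probability term into exactly the average that (A3) sends to zero. -/
lemma tendsto_error (hA : ∀ n i j, Measurable fun ω => A n ω i j)
    (h1 : AssumptionA1 P A) (h3 : AssumptionA3 P A) {V : Type*} [Fintype V] [DecidableEq V]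
    (L : List (Bool × (V × V))) (ε : Bool) (u : V) :
    Tendsto (fun n : ℕ => ((n : ℂ) ^ Fintype.card V)⁻¹ * ∑ f : V → Fin n,
      ∫ ω, listWeight (relabel f L) (A n ω) *
        ((lineAverage ε (A n ω) (f u) - 1 : ℝ) : ℂ) ∂(P n)) atTop (𝓝 0) := by
  obtain ⟨C, hC, hb⟩ := exists_error_bound hA h1 L.length
  have hbound : ∀ δ, 0 < δ → ∀ n : ℕ, 0 < n →
      ‖((n : ℂ) ^ Fintype.card V)⁻¹ * ∑ f : V → Fin n,
        ∫ ω, listWeight (relabel f L) (A n ω) *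
          ((lineAverage ε (A n ω) (f u) - 1 : ℝ) : ℂ) ∂(P n)‖ ≤
      δ * C + δ⁻¹ * ((1 / (n : ℝ)) * ∑ i : Fin n,
        (P n).real {ω | δ ≤ |lineAverage ε (A n ω) i - 1|}) := by
    intro δ hδ n hn
    have hn' : (n : ℝ) ≠ 0 := by positivity
    rw [norm_mul, norm_inv, norm_pow, Complex.norm_natCast]
    have hs := sum_eval (V := V) (fun i : Fin n =>
      (P n).real {ω | δ ≤ |lineAverage ε (A n ω) i - 1|}) u
    have hle : ‖∑ f : V → Fin n, ∫ ω, listWeight (relabel f L) (A n ω) *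
        ((lineAverage ε (A n ω) (f u) - 1 : ℝ) : ℂ) ∂(P n)‖ ≤
        ∑ f : V → Fin n, (δ * C + δ⁻¹ *
          (P n).real {ω | δ ≤ |lineAverage ε (A n ω) (f u) - 1|}) :=
      norm_sum_le_of_le _ fun f _ => hb n _ ε (f u) (by simp [relabel]) δ hδ
    rw [Finset.sum_add_distrib, ← Finset.mul_sum _ _ δ⁻¹] at hle
    simp only [Finset.sum_const, Finset.card_univ, Fintype.card_fun, Fintype.card_fin,
      nsmul_eq_mul, Nat.cast_pow] at hle
    calc _ ≤ ((n : ℝ) ^ Fintype.card V)⁻¹ * _ := mul_le_mul_of_nonneg_left hle (by positivity)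
      _ = δ * C + δ⁻¹ * ((1 / (n : ℝ)) * (((n : ℝ) ^ Fintype.card V)⁻¹ * ((n : ℝ) *
          ∑ f : V → Fin n, (P n).real {ω | δ ≤ |lineAverage ε (A n ω) (f u) - 1|}))) := by
        field_simp
      _ = _ := by rw [hs, inv_mul_cancel_left₀ (pow_ne_zero _ hn')]
  rw [Metric.tendsto_atTop]
  intro η hη
  -- Chosen so that `δ * C ≤ η / 2`; the `+ 1` allows `C = 0`.
  have hδ : 0 < η / (2 * (C + 1)) := by positivity
  set δ := η / (2 * (C + 1)) with hδdef
  have hlim := (h3.tendsto ε hδ).const_mul δ⁻¹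
  rw [mul_zero] at hlim
  obtain ⟨N, hN⟩ := Filter.eventually_atTop.1 (hlim.eventually (gt_mem_nhds (half_pos hη)))
  refine ⟨max N 1, fun n hn => ?_⟩
  rw [dist_zero_right]
  have h4 := hbound δ hδ n (lt_of_lt_of_le one_pos ((le_max_right _ _).trans hn))
  have h5 := hN n ((le_max_left _ _).trans hn)
  have h6 : δ * C ≤ η / 2 := by
    rw [hδdef, div_mul_eq_mul_div, div_le_div_iff₀ (by positivity) two_pos]
    nlinarith
  linarith

/-- The averaged weight of a doubled tree tends to one. -/
theorem tendsto_average_doubledTree (hA : ∀ n i j, Measurable fun ω => A n ω i j)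
    (h1 : AssumptionA1 P A) (h3 : AssumptionA3 P A) {V : Type*} [Fintype V] [DecidableEq V]
    {a : V} {s : List (Bool × V)} (hs : IsDoubledTree a s) :
    Tendsto (fun n : ℕ => ((n : ℂ) ^ Fintype.card V)⁻¹ * ∑ f : V → Fin n,
      ∫ ω, listWeight (relabel f (edgeList a s)) (A n ω) ∂(P n)) atTop (𝓝 1) := by
  induction hs with
  | nil =>
    refine tendsto_const_nhds.congr' ?_
    filter_upwards [eventually_gt_atTop 0] with n hn
    have : (n : ℂ) ≠ 0 := by exact_mod_cast hn.ne'
    simp [relabel, this]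
  -- Averaging over the label of the leaf `b`, which no other step sees, turns its two factors into
  -- the line average at its neighbour: a row if `ε` is `true`, a column otherwise. Writing this as
  -- one plus a deviation gives the induction hypothesis plus the error of `tendsto_error`.
  | insert ε b s t hab hs ht h ih =>
    have hst : b ∉ (s ++ t).map Prod.snd := by simp_all
    have hlim := ih.add (tendsto_error hA h1 h3 (edgeList a (s ++ t)) ε (endpoint a s))
    rw [add_zero] at hlim
    refine hlim.congr' ?_
    filter_upwards [eventually_gt_atTop 0] with n hn
    have hn' : (n : ℂ) ≠ 0 := by exact_mod_cast hn.ne'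
    have hub : endpoint a s ≠ b := by
      rcases eq_or_ne s [] with rfl | hne
      · exact hab.symm
      · exact fun h => hs (h ▸ endpoint_mem a hne)
    let G : (V → Fin n) → Ω n → ℂ := fun f ω => listWeight (relabel f (edgeList a (s ++ t))) (A n ω)
    let S : Fin n → Fin n → Ω n → ℂ := fun i j ω =>
      listWeight [(true, position ε i j), (false, position ε i j)] (A n ω)
    have hGS : ∀ f i j, Integrable (fun ω => G f ω * S i j ω) (P n) := fun f i j => by
      simp only [G, S, ← listWeight_append]
      exact integrable_listWeight hA h1 n _
    have hG : ∀ f, Integrable (G f) (P n) := fun f => integrable_listWeight hA h1 n _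
    have hnew : ∀ f ω, listWeight (relabel f
        (edgeList a (s ++ (ε, b) :: (!ε, endpoint a s) :: t))) (A n ω) =
        G f ω * S (f (endpoint a s)) (f b) ω := by
      intro f ω
      simp only [G, S, relabel, edgeList_append, edgeList_cons, List.map_append, List.map_cons,
        listWeight_append, listWeight_cons, listWeight_nil]
      cases ε <;> simp [position] <;> ring
    have hR : ∀ i ω, ((n : ℂ) * (lineAverage ε (A n ω) i : ℝ)) = ∑ j, S i j ω := by
      intro i ω
      simp only [S, lineAverage, listWeight_cons, listWeight_nil, entry]
      push_cast
      rw [← mul_assoc, mul_one_div_cancel hn', one_mul]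
      exact Finset.sum_congr rfl fun j _ => by simp [Complex.mul_conj']
    have hRf : ∀ f : V → Fin n,
        ∫ ω, G f ω * ((lineAverage ε (A n ω) (f (endpoint a s)) - 1 : ℝ) : ℂ) ∂(P n) =
        (n : ℂ)⁻¹ * ∑ j, ∫ ω, G f ω * S (f (endpoint a s)) j ω ∂(P n) - ∫ ω, G f ω ∂(P n) := by
      intro f
      rw [← integral_finsetSum _ fun j _ => hGS f _ j, ← integral_const_mul,
        ← integral_sub ((integrable_finsetSum _ fun j _ => hGS f _ j).const_mul _) (hG f)]
      refine integral_congr_ae (ae_of_all _ fun ω => ?_)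
      simp only
      rw [← Finset.mul_sum, ← hR]
      push_cast
      field_simp
    have hupd := sum_sum_update
      (fun f : V → Fin n => ∫ ω, G f ω * S (f (endpoint a s)) (f b) ω ∂(P n)) b
    simp only [Function.update_self, Function.update_of_ne hub, G,
      relabel_update _ _ hab hst, nsmul_eq_mul] at hupd
    simp only [hnew]
    rw [← mul_add, ← Finset.sum_add_distrib]
    congr 1
    simp only [G] at hRf ⊢
    simp only [hRf, add_sub_cancel]
    rw [← Finset.mul_sum, hupd, inv_mul_cancel_left₀ hn']

end Trees

/-- The number of shapes of tree walks with the given letters. -/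
noncomputable def treeCount {m : ℕ} (w : Fin m → Bool) : ℕ :=
  Nat.card {π : Setoid (Fin (m + 1)) // IsTreeWalk w (Quotient.mk π)}

lemma treeCount_eq_zero {m : ℕ} {w : Fin m → Bool}
    (hw : Fintype.card {l // w l = true} ≠ Fintype.card {l // w l = false}) :
    treeCount w = 0 := by
  have : IsEmpty {π : Setoid (Fin (m + 1)) // IsTreeWalk w (Quotient.mk π)} :=
    ⟨fun π => hw π.2.balanced⟩
  exact Nat.card_of_isEmpty

lemma walkPosition_eq_map {V : Type*} {m : ℕ} (w : Fin m → Bool) (i : Fin (m + 1) → V)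
    (l : Fin m) : walkPosition w i l = Prod.map i i (walkPosition w id l) :=
  walkPosition_comp w id i l

lemma exists_walkPosition {m : ℕ} (w : Fin m → Bool) (hm : Nonempty (Fin m)) (x : Fin (m + 1)) :
    ∃ l, (walkPosition w id l).1 = x ∨ (walkPosition w id l).2 = x := by
  have key : ∀ l : Fin m, x = l.castSucc ∨ x = l.succ →
      (walkPosition w id l).1 = x ∨ (walkPosition w id l).2 = x := by
    intro l hl
    cases h : w l <;> simp only [walkPosition, position, h] <;> simp [eq_comm, hl, hl.symm]
  obtain ⟨y⟩ := hm
  cases x using Fin.cases with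
  | zero =>
    have := y.pos
    exact ⟨⟨0, this⟩, key _ (.inl rfl)⟩
  | succ l => exact ⟨l, key l (.inr rfl)⟩

lemma listWeight_walk {V : Type*} {m n : ℕ} (w : Fin m → Bool) (i : Fin (m + 1) → V)
    (f : V → Fin n) (B : Matrix (Fin n) (Fin n) ℂ) :
    listWeight (relabel f (edgeList (i 0) (walkSteps w i))) B =
      monomial w (walkPosition w (f ∘ i)) B := by
  rw [edgeList_walkSteps, relabel, listWeight, List.map_ofFn, List.map_ofFn, List.prod_ofFn,
    monomial]
  simp [walkPosition_comp]

/-! ### Balanced words: summing over tree shapes. -/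

section Limits

variable {Ω : ℕ → Type*} [∀ n, MeasurableSpace (Ω n)] {P : ∀ n, Measure (Ω n)}
  {A : ∀ n, Ω n → Matrix (Fin n) (Fin n) ℂ}

lemma simpleMomentSum_nonneg {n k : ℕ} {Ω : Type*} [MeasurableSpace Ω] (P : Measure Ω)
    (A : Ω → Matrix (Fin n) (Fin n) ℂ) : 0 ≤ simpleMomentSum P A k := by
  unfold simpleMomentSum
  refine Finset.sum_nonneg fun r _ => Finset.sum_nonneg fun c _ => ?_
  split_ifs <;> positivity

lemma tendsto_remainder (h2 : AssumptionA2 P A) (C : ℝ) {k r d : ℕ} (hk : k + 1 ≤ d)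
    (hr : r < d) :
    Tendsto (fun n : ℕ => ((n : ℝ) ^ d)⁻¹ * (simpleMomentSum (P n) (A n) k + C * (n : ℝ) ^ r))
      atTop (𝓝 0) := by
  have e1 : (fun n : ℕ => (n : ℝ) ^ (k + 1)) =O[atTop] fun n : ℕ => (n : ℝ) ^ d := by
    refine IsBigO.of_bound 1 ?_
    filter_upwards [eventually_ge_atTop 1] with n hn
    have : (1 : ℝ) ≤ n := by exact_mod_cast hn
    rw [one_mul, norm_pow, norm_pow, Real.norm_natCast]
    exact pow_le_pow_right₀ this hk
  have e2 : (fun n : ℕ => (n : ℝ) ^ r) =o[atTop] fun n : ℕ => (n : ℝ) ^ d :=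
    (isLittleO_pow_pow_atTop_of_lt (𝕜 := ℝ) hr).comp_tendsto tendsto_natCast_atTop_atTop
  have e3 := (((h2 k).trans_isBigO e1).add (e2.const_mul_left C)).tendsto_div_nhds_zero
  refine e3.congr fun n => ?_
  rw [div_eq_inv_mul]

variable [∀ n, IsProbabilityMeasure (P n)]

lemma integral_trace_word (hA : ∀ n i j, Measurable fun ω => A n ω i j)
    (h1 : AssumptionA1 P A) {m : ℕ} (w : Fin m → Bool) (n : ℕ) :
    Integrable (fun ω => (List.ofFn fun l => letter (A n ω) (w l)).prod.trace) (P n) ∧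
    ∫ ω, (List.ofFn fun l => letter (A n ω) (w l)).prod.trace ∂(P n) =
      ∑ i : Fin (m + 1) → Fin n with i 0 = i (Fin.last m),
        ∫ ω, monomial w (walkPosition w i) (A n ω) ∂(P n) := by
  simp only [trace_word, ← Finset.sum_filter]
  have hint : ∀ i : Fin (m + 1) → Fin n,
      Integrable (fun ω => monomial w (walkPosition w i) (A n ω)) (P n) := fun i =>
    integrable_monomial hA h1 n w _
  exact ⟨integrable_finsetSum _ fun i _ => hint i, integral_finsetSum _ fun i _ => hint i⟩

open Classical in
/-- The contribution of the tree walks of a given shape. -/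
lemma tendsto_shape (hA : ∀ n i j, Measurable fun ω => A n ω i j)
    (h1 : AssumptionA1 P A) (h2 : AssumptionA2 P A) (h3 : AssumptionA3 P A) {m p : ℕ}
    (hm : m = 2 * p) (w : Fin m → Bool) (π : Setoid (Fin (m + 1)))
    (hπ : IsTreeWalk w (Quotient.mk π)) :
    Tendsto (fun n : ℕ => ((n : ℂ) ^ (p + 1))⁻¹ *
      ∑ i : Fin (m + 1) → Fin n with Setoid.ker i = π,
        ∫ ω, monomial w (walkPosition w i) (A n ω) ∂(P n)) atTop (𝓝 1) := by
  obtain ⟨hcard, htree⟩ := hπ.isDoubledTree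
  have hQ : Fintype.card (Quotient π) = p + 1 := by
    rw [Set.range_eq_univ.2 Quotient.mk_surjective, Set.ncard_univ,
      Nat.card_eq_fintype_card] at hcard
    omega
  have hlim := tendsto_average_doubledTree hA h1 h3 htree
  simp only [listWeight_walk, hQ] at hlim
  obtain ⟨C, hC⟩ := exists_sum_few_le hA h1 w (walkPosition w id) p
  simp only [← walkPosition_eq_map] at hC
  -- The average over all labellings of the quotient also contains the non-injective ones. These
  -- form `D`; they take at most `p` values and so contribute only `O(n ^ p)`.
  let D : ∀ n : ℕ, Finset (Fin (m + 1) → Fin n) := fun n =>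
    {i | π ≤ Setoid.ker i ∧ Setoid.ker i ≠ π}
  have hall : ∀ n : ℕ, ∑ f : Quotient π → Fin n,
      ∫ ω, monomial w (walkPosition w (f ∘ Quotient.mk π)) (A n ω) ∂(P n) =
      ∑ i : Fin (m + 1) → Fin n with Setoid.ker i = π,
        ∫ ω, monomial w (walkPosition w i) (A n ω) ∂(P n) +
      ∑ i ∈ D n, ∫ ω, monomial w (walkPosition w i) (A n ω) ∂(P n) := by
    intro n
    have e1 := (Setoid.liftEquiv (β := Fin n) π).sum_comp fun f =>
      ∫ ω, monomial w (walkPosition w (f ∘ Quotient.mk π)) (A n ω) ∂(P n)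
    have e2 : ∀ i : {i : Fin (m + 1) → Fin n // π ≤ Setoid.ker i},
        Setoid.liftEquiv π i ∘ Quotient.mk π = i.1 := fun i => rfl
    simp only [e2] at e1
    rw [← e1, ← Finset.sum_subtype ({i | π ≤ Setoid.ker i} : Finset (Fin (m + 1) → Fin n))
      (by simp) fun i => ∫ ω, monomial w (walkPosition w i) (A n ω) ∂(P n),
      ← Finset.sum_filter_add_sum_filter_not
      ({i | π ≤ Setoid.ker i} : Finset (Fin (m + 1) → Fin n)) (fun i => Setoid.ker i = π),
      Finset.filter_filter, Finset.filter_filter]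
    congr 2
    ext i
    simp only [Finset.mem_filter, Finset.mem_univ, true_and, and_iff_right_iff_imp]
    exact fun h => h.ge
  have hsmall : Tendsto (fun n : ℕ => ((n : ℂ) ^ (p + 1))⁻¹ *
      ∑ i ∈ D n, ∫ ω, monomial w (walkPosition w i) (A n ω) ∂(P n)) atTop (𝓝 0) := by
    -- Only the power of `n` is needed; the nonnegative moment sum, with `k := 0`, is added merely
    -- to reuse the remainder estimate.
    refine squeeze_zero_norm (fun n => ?_)
      (tendsto_remainder (P := P) (A := A) h2 C (k := 0) (r := p)
      (d := p + 1) (by omega) (by omega))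
    rw [norm_mul, norm_inv, norm_pow, Complex.norm_natCast]
    refine mul_le_mul_of_nonneg_left ?_ (by positivity)
    refine (norm_sum_le _ _).trans ((hC n (D n) fun i hi => ?_).trans
      (le_add_of_nonneg_left (simpleMomentSum_nonneg _ _)))
    simp only [D, Finset.mem_filter, Finset.mem_univ, true_and] at hi
    have hnot : ¬ Function.Injective (Setoid.liftEquiv π ⟨i, hi.1⟩) := fun h =>
      hi.2 ((Setoid.lift_injective_iff_ker_eq_of_le hi.1).1 h)
    have hr : Set.range i = Set.range (Setoid.liftEquiv π ⟨i, hi.1⟩) :=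
      (Quotient.mk_surjective (s := π)).range_comp (Setoid.liftEquiv π ⟨i, hi.1⟩)
    rw [hr, ← Set.image_univ]
    by_contra! hlt
    refine hnot (Set.injOn_univ.1 (Set.injOn_of_ncard_image_eq (le_antisymm
      (Set.ncard_image_le Set.finite_univ) ?_) Set.finite_univ))
    rw [Set.ncard_univ, Nat.card_eq_fintype_card, hQ]
    exact hlt
  have := hlim.sub hsmall
  rw [sub_zero] at this
  refine this.congr fun n => ?_
  rw [hall, mul_add, add_sub_cancel_right]


lemma finite_setoid (α : Type*) [Finite α] : Finite (Setoid α) :=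
  Finite.of_injective (fun π : Setoid α => (π.r : α → α → Prop)) fun π ρ h =>
    Setoid.ext fun a b => by rw [show π a b = ρ a b from congrFun (congrFun h a) b]

lemma isTreeWalk_ker_iff {V : Type*} {m : ℕ} (w : Fin m → Bool) (i : Fin (m + 1) → V) :
    IsTreeWalk w (Quotient.mk (Setoid.ker i)) ↔ IsTreeWalk w i := by
  rw [← isTreeWalk_comp_iff w _ (Setoid.kerLift_injective i)]
  rfl

-- Tree walks are grouped by their kernels: there are finitely many shapes, each with limit one.
open Classical in
lemma tendsto_sum_treeWalks (hA : ∀ n i j, Measurable fun ω => A n ω i j)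
    (h1 : AssumptionA1 P A) (h2 : AssumptionA2 P A) (h3 : AssumptionA3 P A) {m p : ℕ}
    (hm : m = 2 * p) (w : Fin m → Bool) :
    Tendsto (fun n : ℕ => ((n : ℂ) ^ (p + 1))⁻¹ *
      ∑ i : Fin (m + 1) → Fin n with IsTreeWalk w i,
        ∫ ω, monomial w (walkPosition w i) (A n ω) ∂(P n)) atTop (𝓝 (treeCount w)) := by
  have := finite_setoid (Fin (m + 1))
  have := Fintype.ofFinite (Setoid (Fin (m + 1)))
  have hlim := tendsto_finsetSum (Finset.univ.filter fun π : Setoid (Fin (m + 1)) =>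
    IsTreeWalk w (Quotient.mk π)) fun π hπ =>
      tendsto_shape hA h1 h2 h3 hm w π (Finset.mem_filter.1 hπ).2
  have hc : ∑ _π : Setoid (Fin (m + 1)) with IsTreeWalk w (Quotient.mk _π), (1 : ℂ) =
      treeCount w := by
    rw [treeCount, Nat.card_eq_fintype_card, Fintype.card_subtype]
    simp
  rw [hc] at hlim
  refine hlim.congr fun n => ?_
  rw [← Finset.mul_sum]
  congr 1
  rw [← Finset.sum_fiberwise ({i | IsTreeWalk w i} : Finset (Fin (m + 1) → Fin n)) Setoid.ker,
    Finset.sum_filter]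
  refine Finset.sum_congr rfl fun π _ => ?_
  rw [Finset.filter_filter]
  split_ifs with hπ
  · refine Finset.sum_congr (Finset.filter_congr fun i _ => ?_) fun _ _ => rfl
    refine ⟨fun h => ⟨?_, h⟩, fun h => h.2⟩
    subst h
    exact (isTreeWalk_ker_iff w i).1 hπ
  · refine (Finset.sum_eq_zero fun i hi => ?_).symm
    obtain ⟨h, rfl⟩ := (Finset.mem_filter.1 hi).2
    exact absurd ((isTreeWalk_ker_iff w i).2 h) hπ

/-- With `m = 2 * p` the normalization is `n ^ (p + 1)`. A closed walk that is not a tree walk has a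
simple position, handled by (A2), or at most `p` vertices, handled by (A1). -/
theorem tendsto_balanced_word (hA : ∀ n i j, Measurable fun ω => A n ω i j)
    (h1 : AssumptionA1 P A) (h2 : AssumptionA2 P A) (h3 : AssumptionA3 P A) {m p : ℕ}
    (w : Fin m → Bool) (ht : Fintype.card {l // w l = true} = p)
    (hf : Fintype.card {l // w l = false} = p) :
    Tendsto (fun n : ℕ => (1 / (n : ℂ)) * ((((√n)⁻¹ : ℝ) : ℂ) ^ m *
      ∫ ω, (List.ofFn fun l => letter (A n ω) (w l)).prod.trace ∂(P n)))
      atTop (𝓝 (treeCount w)) := by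
  classical
  have hm : m = 2 * p := by
    obtain ⟨σ, -⟩ := exists_equiv_of_balanced ht hf
    have := Fintype.card_congr σ
    simp only [Fintype.card_sum, Fintype.card_fin] at this
    omega
  have hlim := tendsto_sum_treeWalks hA h1 h2 h3 hm w
  obtain ⟨C, hC⟩ := exists_sum_le hA h1 ht hf (walkPosition w id) (exists_walkPosition w) p
  simp only [← walkPosition_eq_map] at hC
  let D : ∀ n : ℕ, Finset (Fin (m + 1) → Fin n) := fun n =>
    {i | i 0 = i (Fin.last m) ∧ ¬ IsTreeWalk w i}
  have hsmall : Tendsto (fun n : ℕ => ((n : ℂ) ^ (p + 1))⁻¹ *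
      ∑ i ∈ D n, ∫ ω, monomial w (walkPosition w i) (A n ω) ∂(P n)) atTop (𝓝 0) := by
    refine squeeze_zero_norm (fun n => ?_) (tendsto_remainder h2 C (k := p) (r := p)
      (d := p + 1) le_rfl (Nat.lt_succ_self p))
    rw [norm_mul, norm_inv, norm_pow, Complex.norm_natCast]
    refine mul_le_mul_of_nonneg_left ?_ (by positivity)
    refine (norm_sum_le _ _).trans (hC n (D n) fun i hi hns => ?_)
    simp only [D, Finset.mem_filter, Finset.mem_univ, true_and, IsTreeWalk, not_and, not_le] at hi
    have := hi.2 hi.1 hns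
    omega
  have := hlim.add hsmall
  rw [add_zero] at this
  refine this.congr fun n => ?_
  have hs : (((√n)⁻¹ : ℝ) : ℂ) ^ m = ((n : ℂ) ^ p)⁻¹ := by
    rw [hm, pow_mul, ← Complex.ofReal_pow, inv_pow, Real.sq_sqrt (Nat.cast_nonneg n)]
    simp
  rw [(integral_trace_word hA h1 w n).2, hs, ← mul_add, pow_succ', mul_inv, one_div, mul_assoc]
  congr 2
  rw [← Finset.sum_filter_add_sum_filter_not
    ({i | i 0 = i (Fin.last m)} : Finset (Fin (m + 1) → Fin n)) (fun i => IsTreeWalk w i),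
    Finset.filter_filter, Finset.filter_filter]
  congr 2
  ext i
  simp only [Finset.mem_filter, Finset.mem_univ, true_and]
  exact ⟨fun h => ⟨h.1, h⟩, fun h => h.2⟩

end Limits

/-! ### Unbalanced words: a second moment estimate. -/

section Unbalanced

variable {m : ℕ}

/-- The letters of a word together with the opposite letters. -/
def pairLetters (w : Fin m → Bool) : Fin m ⊕ Fin m → Bool := Sum.elim w fun l => !w l

/-- The steps of two disjoint walks. -/
def pairSteps (w : Fin m → Bool) :
    Fin m ⊕ Fin m → (Fin (m + 1) ⊕ Fin (m + 1)) × (Fin (m + 1) ⊕ Fin (m + 1)) :=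
  Sum.elim (fun l => Prod.map Sum.inl Sum.inl (walkPosition w id l))
    fun l => Prod.map Sum.inr Sum.inr (walkPosition w id l)

lemma map_pairSteps {V : Type*} (w : Fin m → Bool) (i j : Fin (m + 1) → V) :
    (fun l => Prod.map (Sum.elim i j) (Sum.elim i j) (pairSteps w l)) =
      Sum.elim (walkPosition w i) (walkPosition w j) := by
  ext1 l
  rcases l with l | l
  · rw [Sum.elim_inl, walkPosition_eq_map w i]; rfl
  · rw [Sum.elim_inr, walkPosition_eq_map w j]; rfl

lemma monomial_pair {n : ℕ} (w : Fin m → Bool) (e e' : Fin m → Fin n × Fin n)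
    (B : Matrix (Fin n) (Fin n) ℂ) :
    monomial (pairLetters w) (Sum.elim e e') B = monomial w e B * conj (monomial w e' B) := by
  simp only [monomial, Fintype.prod_sum_type, pairLetters, Sum.elim_inl, Sum.elim_inr, map_prod]
  congr 1
  refine Finset.prod_congr rfl fun l _ => ?_
  cases w l <;> simp [entry]

/-- Each letter is paired with its opposite, so the squared modulus of the trace is within reach of
(A2) for any word. -/
lemma card_pairLetters (w : Fin m → Bool) (b : Bool) :
    Fintype.card {l // pairLetters w l = b} = m := by
  rw [Fintype.card_subtype, Finset.card_filter, Fintype.sum_sum_type, ← Finset.sum_add_distrib]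
  have : ∀ l, ((if pairLetters w (.inl l) = b then 1 else 0) +
      if pairLetters w (.inr l) = b then 1 else 0) = 1 := by
    intro l
    simp only [pairLetters, Sum.elim_inl, Sum.elim_inr]
    by_cases h : w l = true <;> cases b <;> simp [h]
  simp [this]

variable {Ω : ℕ → Type*} [∀ n, MeasurableSpace (Ω n)] {P : ∀ n, Measure (Ω n)}
  {A : ∀ n, Ω n → Matrix (Fin n) (Fin n) ℂ} [∀ n, IsProbabilityMeasure (P n)]

lemma normSq_trace_word {n : ℕ} (B : Matrix (Fin n) (Fin n) ℂ) (w : Fin m → Bool) :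
    ((‖(List.ofFn fun l => letter B (w l)).prod.trace‖ ^ 2 : ℝ) : ℂ) =
      ∑ I : Fin (m + 1) ⊕ Fin (m + 1) → Fin n with
        I (.inl 0) = I (.inl (Fin.last m)) ∧ I (.inr 0) = I (.inr (Fin.last m)),
        monomial (pairLetters w) (fun l => Prod.map I I (pairSteps w l)) B := by
  rw [Complex.ofReal_pow, ← Complex.mul_conj', trace_word, map_sum, Finset.sum_mul_sum,
    Finset.sum_filter, ← (Equiv.sumArrowEquivProdArrow _ _ _).symm.sum_comp,
    Fintype.sum_prod_type]
  refine Finset.sum_congr rfl fun i _ => Finset.sum_congr rfl fun j _ => ?_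
  have : (Equiv.sumArrowEquivProdArrow (Fin (m + 1)) (Fin (m + 1)) (Fin n)).symm (i, j) =
    Sum.elim i j := rfl
  rw [this, map_pairSteps, monomial_pair]
  simp only [Sum.elim_inl, Sum.elim_inr]
  by_cases h1 : i 0 = i (Fin.last m) <;> by_cases h2 : j 0 = j (Fin.last m) <;>
    simp [h1, h2, monomial]

/-- The second moment of the trace of an unbalanced word. -/
lemma exists_integral_normSq_le (hA : ∀ n i j, Measurable fun ω => A n ω i j)
    (h1 : AssumptionA1 P A) (w : Fin m → Bool)
    (hw : Fintype.card {l // w l = true} ≠ Fintype.card {l // w l = false}) :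
    ∃ C : ℝ, ∀ n,
      Integrable (fun ω => ‖(List.ofFn fun l => letter (A n ω) (w l)).prod.trace‖ ^ 2) (P n) ∧
      ∫ ω, ‖(List.ofFn fun l => letter (A n ω) (w l)).prod.trace‖ ^ 2 ∂(P n) ≤
        simpleMomentSum (P n) (A n) m + C * (n : ℝ) ^ (m + 1) := by
  obtain ⟨C, hC⟩ := exists_sum_le hA h1 (card_pairLetters w true) (card_pairLetters w false)
    (pairSteps w) (by
      rintro ⟨l⟩ x
      have hl : Nonempty (Fin m) := ⟨l.elim id id⟩
      rcases x with x | x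
      · obtain ⟨y, hy⟩ := exists_walkPosition w hl x
        exact ⟨.inl y, by simpa [pairSteps] using hy⟩
      · obtain ⟨y, hy⟩ := exists_walkPosition w hl x
        exact ⟨.inr y, by simpa [pairSteps] using hy⟩) (m + 1)
  refine ⟨C, fun n => ?_⟩
  have hint : ∀ I : Fin (m + 1) ⊕ Fin (m + 1) → Fin n, Integrable (fun ω =>
      monomial (pairLetters w) (fun l => Prod.map I I (pairSteps w l)) (A n ω)) (P n) :=
    fun I => integrable_monomial hA h1 n _ _
  constructor
  · have h : Integrable (fun ω =>
        ((‖(List.ofFn fun l => letter (A n ω) (w l)).prod.trace‖ ^ 2 : ℝ) : ℂ)) (P n) := by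
      simp only [normSq_trace_word]
      exact integrable_finsetSum _ fun I _ => hint I
    exact h.re
  · have hC' := hC n {I | I (.inl 0) = I (.inl (Fin.last m)) ∧ I (.inr 0) = I (.inr (Fin.last m))}
      (by
        intro I hI hns
        simp only [Finset.mem_filter, Finset.mem_univ, true_and] at hI
        obtain ⟨⟨i, j⟩, rfl⟩ := (Equiv.sumArrowEquivProdArrow _ _ _).symm.surjective I
        change ¬ IsSimple (fun l => Prod.map (Sum.elim i j) (Sum.elim i j) (pairSteps w l)) at hns
        rw [map_pairSteps] at hns
        exact ncard_range_elim_le hw hI.1 hI.2 hns)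
    refine le_trans ?_ ((norm_sum_le _ _).trans hC')
    rw [← integral_finsetSum _ fun I _ => hint I]
    simp only [← normSq_trace_word]
    rw [integral_complex_ofReal, Complex.norm_real]
    exact le_abs_self _

theorem tendsto_unbalanced_word (hA : ∀ n i j, Measurable fun ω => A n ω i j)
    (h1 : AssumptionA1 P A) (h2 : AssumptionA2 P A) (w : Fin m → Bool)
    (hw : Fintype.card {l // w l = true} ≠ Fintype.card {l // w l = false}) :
    Tendsto (fun n : ℕ => (1 / (n : ℂ)) * ((((√n)⁻¹ : ℝ) : ℂ) ^ m *
      ∫ ω, (List.ofFn fun l => letter (A n ω) (w l)).prod.trace ∂(P n)))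
      atTop (𝓝 0) := by
  obtain ⟨C, hC⟩ := exists_integral_normSq_le hA h1 w hw
  -- The exponent `m + 2` comes from squaring the normalization `n⁻¹ * (√n)⁻¹ ^ m`; the second
  -- moment is only `O(n ^ (m + 1))`.
  have hlim := tendsto_remainder h2 C (k := m) (r := m + 1) (d := m + 2) (by omega) (by omega)
  have hsqrt := (Real.continuous_sqrt.tendsto 0).comp hlim
  rw [Real.sqrt_zero] at hsqrt
  refine squeeze_zero_norm (fun n => ?_) hsqrt
  refine Real.le_sqrt_of_sq_le ?_
  obtain ⟨hint2, hle⟩ := hC n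
  have hint := (integral_trace_word hA h1 w n).1
  set T := fun ω => (List.ofFn fun l => letter (A n ω) (w l)).prod.trace
  have hjensen : ‖∫ ω, T ω ∂(P n)‖ ^ 2 ≤ ∫ ω, ‖T ω‖ ^ 2 ∂(P n) := by
    -- The variance of `‖T‖` is nonnegative.
    set c := ∫ ω, ‖T ω‖ ∂(P n) with hc
    have h3 : ‖∫ ω, T ω ∂(P n)‖ ≤ c := norm_integral_le_integral_norm _
    have h4 : 0 ≤ ∫ ω, (‖T ω‖ ^ 2 - (2 * c) * ‖T ω‖ + c ^ 2) ∂(P n) :=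
      integral_nonneg fun ω => by
        have := sq_nonneg (‖T ω‖ - c)
        simp only [Pi.zero_apply]
        linarith
    have hI : Integrable (fun ω => ‖T ω‖ ^ 2 - (2 * c) * ‖T ω‖) (P n) :=
      hint2.sub (hint.norm.const_mul _)
    rw [integral_add hI (integrable_const _), integral_sub hint2 (hint.norm.const_mul _),
      integral_const_mul, ← hc] at h4
    simp only [integral_const, probReal_univ, one_smul] at h4
    have h5 : ‖∫ ω, T ω ∂(P n)‖ ^ 2 ≤ c ^ 2 := by gcongr
    linarith
  have hs : (((√n)⁻¹) ^ m) ^ 2 = ((n : ℝ) ^ m)⁻¹ := by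
    rw [← pow_mul, mul_comm, pow_mul, inv_pow, Real.sq_sqrt (Nat.cast_nonneg n), inv_pow]
  rw [norm_mul, norm_mul, norm_pow, norm_div, norm_one, Complex.norm_natCast, Complex.norm_real,
    Real.norm_of_nonneg (by positivity), mul_pow, mul_pow, hs]
  simp only
  rw [pow_add _ m 2, mul_inv]
  calc (1 / (n : ℝ)) ^ 2 * (((n : ℝ) ^ m)⁻¹ * ‖∫ ω, T ω ∂(P n)‖ ^ 2)
      = ((n : ℝ) ^ m)⁻¹ * ((n : ℝ) ^ 2)⁻¹ * ‖∫ ω, T ω ∂(P n)‖ ^ 2 := by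
        rw [one_div, inv_pow]; ring
    _ ≤ _ := mul_le_mul_of_nonneg_left (hjensen.trans hle) (by positivity)

end Unbalanced

/-! ### Assembling the words into the moments of `H(z)`. -/

section Main

variable {Ω : ℕ → Type*} [∀ n, MeasurableSpace (Ω n)] {P : ∀ n, Measure (Ω n)}
  {A : ∀ n, Ω n → Matrix (Fin n) (Fin n) ℂ} [∀ n, IsProbabilityMeasure (P n)]

/-- The limit of the normalized expected trace of any word in `A / √n` and its adjoint. -/
theorem tendsto_word (hA : ∀ n i j, Measurable fun ω => A n ω i j)
    (h1 : AssumptionA1 P A) (h2 : AssumptionA2 P A) (h3 : AssumptionA3 P A) (w : List Bool) :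
    (∀ n, Integrable (fun ω => (w.map (letter (A n ω))).prod.trace) (P n)) ∧
    Tendsto (fun n : ℕ => (1 / (n : ℂ)) * ((((√n)⁻¹ : ℝ) : ℂ) ^ w.length *
      ∫ ω, (w.map (letter (A n ω))).prod.trace ∂(P n))) atTop (𝓝 (treeCount w.get)) := by
  have hw : ∀ n ω, w.map (letter (A n ω)) = List.ofFn fun l => letter (A n ω) (w.get l) :=
    fun n ω => by
      conv_lhs => rw [← List.ofFn_get w]
      rw [List.map_ofFn]
      rfl
  simp only [hw]
  refine ⟨fun n => (integral_trace_word hA h1 _ n).1, ?_⟩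
  by_cases h : Fintype.card {l // w.get l = true} = Fintype.card {l // w.get l = false}
  · exact tendsto_balanced_word hA h1 h2 h3 w.get h rfl
  · rw [treeCount_eq_zero h, Nat.cast_zero]
    exact tendsto_unbalanced_word hA h1 h2 w.get h

/-- The limiting moments. -/
noncomputable def limitMoment (k : ℕ) (x : ℝ) : ℝ :=
  ((expansion k).map fun t => x ^ t.1 * (treeCount t.2.2.get : ℝ)).sum

/-- Unbalanced words have no tree shapes, and for balanced ones the two exponents agree, so that
`-z` and `-conj z` combine to a power of `‖z‖ ^ 2`. -/
lemma limitMoment_normSq (k : ℕ) (z : ℂ) :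
    ((limitMoment k (‖z‖ ^ 2) : ℝ) : ℂ) = ((expansion k).map fun t =>
      ((-z) ^ t.1 * (-conj z) ^ t.2.1) * (treeCount t.2.2.get : ℂ)).sum := by
  rw [limitMoment, ← Complex.ofRealHom_eq_coe, map_list_sum, List.map_map]
  congr 1
  refine List.map_congr_left fun t ht => ?_
  simp only [Function.comp, Complex.ofRealHom_eq_coe, Complex.ofReal_mul, Complex.ofReal_natCast,
    Complex.ofReal_pow]
  by_cases h : Fintype.card {l // t.2.2.get l = true} = Fintype.card {l // t.2.2.get l = false}
  · obtain ⟨e1, e2⟩ := expansion_count ht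
    have hab : t.2.1 = t.1 := by
      rw [← count_ofFn_bool, ← count_ofFn_bool, List.ofFn_get] at h
      omega
    rw [hab, ← mul_pow, neg_mul_neg, Complex.mul_conj']
  · rw [treeCount_eq_zero h]
    simp

lemma integral_list_sum {α Ω' : Type*} [MeasurableSpace Ω'] {Q : Measure Ω'} (l : List α)
    {f : α → Ω' → ℂ} (hf : ∀ a ∈ l, Integrable (f a) Q) :
    Integrable (fun ω => (l.map fun a => f a ω).sum) Q ∧
      ∫ ω, (l.map fun a => f a ω).sum ∂Q = (l.map fun a => ∫ ω, f a ω ∂Q).sum := by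
  induction l with
  | nil => simp
  | cons a l ih =>
    obtain ⟨h1, h2⟩ := ih fun b hb => hf b (List.mem_cons_of_mem _ hb)
    have h3 := hf a List.mem_cons_self
    simp only [List.map_cons, List.sum_cons]
    exact ⟨h3.add h1, by rw [integral_add h3 h1, h2]⟩

theorem tendsto_hermitized (hA : ∀ n i j, Measurable fun ω => A n ω i j)
    (h1 : AssumptionA1 P A) (h2 : AssumptionA2 P A) (h3 : AssumptionA3 P A) (k : ℕ) (z : ℂ) :
    (∀ n, Integrable (fun ω => (hermitized (A n ω) z ^ k).trace) (P n)) ∧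
    Tendsto (fun n : ℕ => (1 / (n : ℂ)) * ∫ ω, (hermitized (A n ω) z ^ k).trace ∂(P n))
      atTop (𝓝 ((limitMoment k (‖z‖ ^ 2) : ℝ) : ℂ)) := by
  have hword := fun t : ℕ × ℕ × List Bool => tendsto_word hA h1 h2 h3 t.2.2
  have hsum := fun n => integral_list_sum (Q := P n) (expansion k)
    (f := fun t ω => ((-z) ^ t.1 * (-conj z) ^ t.2.1) * ((((√n)⁻¹ : ℝ) : ℂ) ^ t.2.2.length *
        (t.2.2.map (letter (A n ω))).prod.trace))
    fun t _ => (((hword t).1 n).const_mul _).const_mul _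
  simp only [hermitized_pow_trace]
  refine ⟨fun n => (hsum n).1, ?_⟩
  rw [limitMoment_normSq]
  have hlim := tendsto_list_sum (expansion k) fun t _ =>
    (hword t).2.const_mul ((-z) ^ t.1 * (-conj z) ^ t.2.1)
  refine hlim.congr fun n => ?_
  rw [(hsum n).2, ← List.sum_map_mul_left]
  congr 1
  refine List.map_congr_left fun t _ => ?_
  rw [integral_const_mul, integral_const_mul]
  ring

end Main

end RowMatrix

theorem mainTheorem2 :
    ∃ μ : ℕ → ℝ → ℝ,
      ∀ (Ω : ℕ → Type*) [∀ n, MeasurableSpace (Ω n)]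
        (P : ∀ n, Measure (Ω n)) [∀ n, IsProbabilityMeasure (P n)]
        (A : ∀ n, Ω n → Matrix (Fin n) (Fin n) ℂ),
        (∀ n i j, Measurable fun ω => A n ω i j) →
        (∀ n, iIndepFun (fun (i : Fin n) (ω : Ω n) (j : Fin n) => A n ω i j) (P n)) →
        RowMatrix.AssumptionA1 P A →
        RowMatrix.AssumptionA2 P A →
        RowMatrix.AssumptionA3 P A →
        ∀ (k : ℕ) (z : ℂ),
          (∀ n, Integrable (fun ω => (RowMatrix.hermitized (A n ω) z ^ k).trace) (P n)) ∧
          Tendsto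
            (fun n : ℕ =>
              (1 / (n : ℂ)) * ∫ ω, (RowMatrix.hermitized (A n ω) z ^ k).trace ∂(P n))
            atTop (𝓝 ((μ k (‖z‖ ^ 2) : ℝ) : ℂ)) :=
  ⟨RowMatrix.limitMoment, fun _ _ _ _ _ hA _ h1 h2 h3 k z =>
    RowMatrix.tendsto_hermitized hA h1 h2 h3 k z⟩
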